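/- Let $G$ and $M$ be finite-dimensional smooth Hausdorff manifolds without boundary and let $(G,M)$ be a Lie groupoid with source $\alpha$ and target $\beta$: the product $gh$ is defined when $\beta(g)=\alpha(h)$, $\alpha(gh)=\alpha(g)$, $\beta(gh)=\beta(h)$, $\alpha$ and $\beta$ are submersions, multiplication, inversion and the inclusion of units $M\to G$ are smooth, and $M$ is regarded as a subset of $G$ through this inclusion. The Lie algebroid of $(G,M)$ is the vector bundle over $M$ with fibre $T_x\alpha^{-1}(x)$ at $x$. A smooth section $X$ of it defines the left invariant vector field $\overleftarrow{X}_g=(L_g)_*X_{\beta(g)}$ on $G$, where $L_g(h)=gh$. If $X$ has compact support, $\overleftarrow{X}$ is complete, and $\exp X:M\to G$ maps $y$ to the value at time $1$ of the integral curve of $\overleftarrow{X}$ starting at $y\in M\subset G$. A bisection is a smooth map $s:M\to G$ such that $\alpha\circ s=\mathrm{id}_M$ and $\beta\circ s$ is a diffeomorphism of $M$; the product of bisections is $(sw)(y)=s(y)\,w(\beta(s(y)))$. Theorem 3.2. Let $x\in M$, let $g\in\alpha^{-1}(x)$, and let $\widetilde U$ be a connected open subset of $\alpha^{-1}(x)$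 that contains $x$ and $g$. Let $U\subset M$ be an open set containing $\beta(\widetilde U)$. Then there is a bisection $s$ of $(G,M)$ such that $s(x)=g$ and $s(y)=y$ for all $y\in M\setminus U$. Moreover, $s$ can be chosen to be a finite product $s=\exp X_1\exp X_2\cdots\exp X_k$, where $X_1,\dots,X_k$ are smooth sections of the Lie algebroid with compact supports contained in $U$. -/

import Mathlib

open scoped Manifold ContDiff Topology

noncomputable section

/-- A Lie groupoid with arrow manifold `G` (modelled on `F`) and base manifold `M` (modelled on
`E`). The product `g h` is meaningful when `target g = source h`; the values of `mul` on other pairs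
carry no meaning and are never used. The base is regarded as a subset of `G` through `unit`, which
is automatically an embedding, being a smooth section of `source`.

Since the composable pairs form an embedded submanifold of `G × G`, smoothness of the
multiplication on this submanifold is the same as `ContMDiffOn` for that subset of `G × G`. -/
structure LieGroupoid (E F M G : Type*)
    [NormedAddCommGroup E] [NormedSpace ℝ E] [NormedAddCommGroup F] [NormedSpace ℝ F]
    [TopologicalSpace M] [ChartedSpace E M] [TopologicalSpace G] [ChartedSpace F G] where
  /-- the source map `α` -/
  source : G → M
  /-- the target map `β` -/
  target : G → M
  /-- the inclusion `x ↦ 1_x` of the base -/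
  unit : M → G
  /-- the partial multiplication `(g, h) ↦ g h`, for `target g = source h` -/
  mul : G → G → G
  /-- the inversion -/
  inv : G → G
  source_mul : ∀ g h, target g = source h → source (mul g h) = source g
  target_mul : ∀ g h, target g = source h → target (mul g h) = target h
  mul_assoc : ∀ f g h, target f = source g → target g = source h →
    mul f (mul g h) = mul (mul f g) h
  source_unit : ∀ x, source (unit x) = x
  target_unit : ∀ x, target (unit x) = x
  mul_unit : ∀ g, mul g (unit (target g)) = g
  unit_mul : ∀ g, mul (unit (source g)) g = g
  source_inv : ∀ g, source (inv g) = target g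
  target_inv : ∀ g, target (inv g) = source g
  inv_mul : ∀ g, mul (inv g) g = unit (target g)
  mul_inv : ∀ g, mul g (inv g) = unit (source g)
  isSubmersion_source : Manifold.IsSubmersion 𝓘(ℝ, F) 𝓘(ℝ, E) ∞ source
  isSubmersion_target : Manifold.IsSubmersion 𝓘(ℝ, F) 𝓘(ℝ, E) ∞ target
  contMDiff_unit : ContMDiff 𝓘(ℝ, E) 𝓘(ℝ, F) ∞ unit
  contMDiff_inv : ContMDiff 𝓘(ℝ, F) 𝓘(ℝ, F) ∞ inv
  contMDiffOn_mul : ContMDiffOn (𝓘(ℝ, F).prod 𝓘(ℝ, F)) 𝓘(ℝ, F) ∞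
    (fun p : G × G => mul p.1 p.2) {p : G × G | target p.1 = source p.2}

namespace LieGroupoid

variable {E F M G : Type*}
  [NormedAddCommGroup E] [NormedSpace ℝ E] [NormedAddCommGroup F] [NormedSpace ℝ F]
  [TopologicalSpace M] [ChartedSpace E M] [TopologicalSpace G] [ChartedSpace F G]

/-- The `α`-fibre over `x`. -/
def sourceFiber (𝒢 : LieGroupoid E F M G) (x : M) : Set G := {g | 𝒢.source g = x}

/-- A bisection: a smooth map `s : M → G` with `α ∘ s = id` and `β ∘ s` a diffeomorphism of `M`. -/
structure IsBisection (𝒢 : LieGroupoid E F M G) (s : M → G) : Prop where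
  contMDiff : ContMDiff 𝓘(ℝ, E) 𝓘(ℝ, F) ∞ s
  source_apply : ∀ x, 𝒢.source (s x) = x
  target_diffeo : ∃ Φ : M ≃ₘ^∞⟮𝓘(ℝ, E), 𝓘(ℝ, E)⟯ M, ∀ x, Φ x = 𝒢.target (s x)

/-- The product of bisections, `(s w)(x) = s(x) w(β(s(x)))`. -/
def secMul (𝒢 : LieGroupoid E F M G) (s w : M → G) : M → G :=
  fun x => 𝒢.mul (s x) (w (𝒢.target (s x)))

/-- The product `s₁ s₂ ⋯ s_k` of a list of bisections; the empty product is the identity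
bisection `x ↦ 1_x`. -/
def secProd (𝒢 : LieGroupoid E F M G) (l : List (M → G)) : M → G :=
  l.foldr 𝒢.secMul 𝒢.unit

/-- A smooth section of the Lie algebroid, whose fibre at `x` is the tangent space at `1_x` of the
`α`-fibre over `x`, that is, the kernel of the differential of `α` at `1_x`. -/
structure AlgebroidSection (𝒢 : LieGroupoid E F M G) [IsManifold 𝓘(ℝ, F) ∞ G] where
  /-- the value at `x` -/
  val : ∀ x : M, TangentSpace 𝓘(ℝ, F) (𝒢.unit x)
  mfderiv_source : ∀ x, mfderiv 𝓘(ℝ, F) 𝓘(ℝ, E) 𝒢.source (𝒢.unit x) (val x) = 0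
  contMDiff : ContMDiff 𝓘(ℝ, E) 𝓘(ℝ, F).tangent ∞
    (fun x => (⟨𝒢.unit x, val x⟩ : TangentBundle 𝓘(ℝ, F) G))

namespace AlgebroidSection

variable {𝒢 : LieGroupoid E F M G} [IsManifold 𝓘(ℝ, F) ∞ G]

/-- The support of a section: the closure of the set where it does not vanish. -/
def support (X : 𝒢.AlgebroidSection) : Set M := closure {x | X.val x ≠ 0}

/-- The left invariant vector field of `X`: at `g` it is the image of `X (β g)` under the
differential at `1_{β g}` of the left translation `h ↦ g h`, a map defined on the `α`-fibre over
`β g`. Derivatives within this fibre are determined on the vectors tangent to the fibre, and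
`X (β g)` is such a vector. The cast identifies the tangent spaces at `g 1_{β g}` and at `g`. -/
def leftInvariant (X : 𝒢.AlgebroidSection) (g : G) : TangentSpace 𝓘(ℝ, F) g :=
  cast (congrArg (fun h : G => TangentSpace 𝓘(ℝ, F) h) (𝒢.mul_unit g))
    (mfderivWithin 𝓘(ℝ, F) 𝓘(ℝ, F) (fun h => 𝒢.mul g h) (𝒢.sourceFiber (𝒢.target g))
      (𝒢.unit (𝒢.target g)) (X.val (𝒢.target g)))

/-- `s = exp X`: for every `x`, the integral curve of the left invariant vector field of `X` that
starts at `1_x` is defined on all of `ℝ`, and `s x` is its value at time `1`. -/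
def IsExp (X : 𝒢.AlgebroidSection) (s : M → G) : Prop :=
  ∀ x, ∃ γ : ℝ → G,
    IsMIntegralCurve (I := 𝓘(ℝ, F)) γ X.leftInvariant ∧ γ 0 = 𝒢.unit x ∧ γ 1 = s x

end AlgebroidSection

/-- `s` is finitely generated over `U`: it is a product `exp X₁ exp X₂ ⋯ exp X_k`, where each `X_i`
is a section of the Lie algebroid with compact support contained in `U`. -/
def IsFinitelyGeneratedOver (𝒢 : LieGroupoid E F M G) [IsManifold 𝓘(ℝ, F) ∞ G]
    (U : Set M) (s : M → G) : Prop :=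
  ∃ (k : ℕ) (X : Fin k → 𝒢.AlgebroidSection) (e : Fin k → M → G),
    (∀ i, IsCompact (X i).support ∧ (X i).support ⊆ U ∧ (X i).IsExp (e i)) ∧
    s = 𝒢.secProd (List.ofFn e)

end LieGroupoid

end

/-!
The proof moves along the connected set `Utilde` in small steps, each of which is right
multiplication by the exponential of one section of the Lie algebroid.

*Flows.* Smooth dependence of solutions of `γ' = f ∘ γ` on time and initial value is obtained from
the inverse function theorem on `ℝ × C([0, 1], E)`: the map `odeMap f`, which sends `(τ, α)` to
`(τ, α - τ ∫₀ f ∘ α)`, is smooth, its derivative at `τ = 0` is a shear, and the solution with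
initial value `z`, rescaled from `[0, τ]` to `[0, 1]`, is the preimage of `(τ, z)`
(`ContDiff.exists_contDiffOn_flow`). A chart transports this to manifolds
(`exists_contMDiffOn_localFlow`).

*Exponentials.* In a local trivialization of the source map (`FibreChart`), the left invariant
vector field of a section is the velocity at `t = 0` of `t ↦ g c(t)` for an explicit smooth family
of curves `c` in the source fibres, hence smooth (`contMDiff_leftInvariant`). Left translation
carries integral curves to integral curves. For a section with compact support, the integral curves
starting at units therefore exist for a uniform time, and so do all integral curves, which makes the
field complete. The cocycle identity `e (s + t) y = e s y · e t (β (e s y))` (`IsFlow.add`) makes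
`exp (t X)` a power of `exp (t X / n)`, hence smooth, and gives `exp (-X)` as the inverse of
`exp X`, so that `exp X` is a bisection (`IsFlow.isBisection`).

*Local transitivity.* In a fibre chart at `1_{y₀}`, the constant coordinate vectors `w`, cut off
near `y₀`, give a linear family of sections `X_w` supported in `U`. The flow of the field
`(X_w, 0)` on `G × W` shows that `w ↦ exp (τ X_w) (y₀)` is smooth for small `τ > 0`; its derivative
at `0` is `τ` times the identity in the coordinate of the fibre, so that its values fill a
neighbourhood of `1_{y₀}` in the source fibre (`eventually_exists_exp`).

After a left translation, every arrow `k` close to `h` in a source fibre with `β h ∈ U` is of the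
form `h · exp X (β h)`, and `h = k · exp (-X) (β k)` (`eventually_reaches`). Reachability by
products of such exponentials is transitive, so connectedness of `Utilde` gives the theorem.
-/

/-! ### Composition and integration operators on spaces of continuous functions -/

noncomputable section
open Set Metric

namespace ContinuousMap

universe u
variable {K : Type*} [TopologicalSpace K] [CompactSpace K]
  {E F : Type u} [NormedAddCommGroup E] [NormedSpace ℝ E] [NormedAddCommGroup F] [NormedSpace ℝ F]

/-- Pointwise application of a family of continuous linear maps to a family of vectors, as a
continuous bilinear map on spaces of continuous functions on a compact space. -/
def pointwiseApply : C(K, E →L[ℝ] F) →L[ℝ] C(K, E) →L[ℝ] C(K, F) :=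
  LinearMap.mkContinuous₂
    (LinearMap.mk₂ ℝ (fun (A : C(K, E →L[ℝ] F)) (α : C(K, E)) =>
        (⟨fun k => A k (α k), by fun_prop⟩ : C(K, F)))
      (fun A B α => by ext; simp) (fun c A α => by ext; simp)
      (fun A α β => by ext; simp) (fun c A α => by ext; simp)) 1
    (fun A α => by
      rw [one_mul, ContinuousMap.norm_le _ (by positivity)]
      intro k
      refine ((A k).le_opNorm _).trans ?_
      gcongr
      · exact A.norm_coe_le_norm k
      · exact α.norm_coe_le_norm k)

@[simp]
lemma pointwiseApply_apply (A : C(K, E →L[ℝ] F)) (α : C(K, E)) (k : K) :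
    pointwiseApply A α k = A k (α k) := rfl

/-- The derivative of `β ↦ f ∘ β` is pointwise application of `f' ∘ β`. The estimate has to be
uniform over `K`, and the bound on `f'` near `α k` for all `k` at once comes from continuity of
`β ↦ f' ∘ β`, tested on the translates of `α` by constants. -/
lemma hasFDerivAt_comp_left (f : C(E, F)) (f' : C(E, E →L[ℝ] F))
    (hf : ∀ x, HasFDerivAt f (f' x) x) (α : C(K, E)) :
    HasFDerivAt (fun β : C(K, E) => f.comp β) (pointwiseApply (f'.comp α)) α := by
  rw [hasFDerivAt_iff_isLittleO_nhds_zero, Asymptotics.isLittleO_iff]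
  intro c hc
  have hcont : Continuous fun β : C(K, E) => f'.comp β := f'.continuous_postcomp
  obtain ⟨δ, hδ, hball⟩ := Metric.mem_nhds_iff.1
    (hcont.continuousAt.preimage_mem_nhds (Metric.ball_mem_nhds (f'.comp α) hc))
  filter_upwards [Metric.ball_mem_nhds (0 : C(K, E)) hδ] with h hh
  rw [mem_ball_zero_iff] at hh
  rw [ContinuousMap.norm_le _ (by positivity)]
  intro k
  have key : ∀ y ∈ ball (α k) δ, ‖f' y - f' (α k)‖ ≤ c := by
    intro y hy
    have h1 := @hball (α + ContinuousMap.const K (y - α k)) (by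
      rw [mem_ball, dist_eq_norm, add_sub_cancel_left]
      exact lt_of_le_of_lt (b := ‖y - α k‖)
        ((ContinuousMap.norm_le _ (norm_nonneg _)).2 fun _ => le_rfl)
        (by simpa [dist_eq_norm] using hy))
    have h2 := (ContinuousMap.dist_apply_le_dist k).trans (le_of_lt h1)
    simpa [dist_eq_norm] using h2
  have hmv := (convex_ball (α k) δ).norm_image_sub_le_of_norm_hasFDerivWithin_le'
    (f := f) (f' := f') (φ := f' (α k)) (C := c)
    (fun x _ => (hf x).hasFDerivWithinAt) key (mem_ball_self hδ)
    (y := α k + h k) (by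
      simpa [dist_eq_norm] using (h.norm_coe_le_norm k).trans_lt hh)
  simp only [add_sub_cancel_left] at hmv
  exact hmv.trans (mul_le_mul_of_nonneg_left (h.norm_coe_le_norm k) hc.le)

/-- Composition on the left with a `C^n` map is a `C^n` operator between spaces of continuous
functions on a compact space. -/
lemma contDiff_comp_left_nat (n : ℕ) : ∀ {F : Type u} [NormedAddCommGroup F] [NormedSpace ℝ F]
    (f : C(E, F)), ContDiff ℝ n f → ContDiff ℝ n (fun β : C(K, E) => f.comp β) := by
  induction n with
  | zero =>
    intro F _ _ f _
    rw [Nat.cast_zero, contDiff_zero]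
    exact f.continuous_postcomp
  | succ n ih =>
    intro F _ _ f hf
    rw [Nat.cast_succ, contDiff_succ_iff_hasFDerivAt]
    push_cast at hf
    have hf1 : ContDiff ℝ 1 f := hf.of_le (by simp)
    let f' : C(E, E →L[ℝ] F) := ⟨fderiv ℝ f, hf1.continuous_fderiv (by simp)⟩
    have hf' : ContDiff ℝ n f' := hf.fderiv_right le_rfl
    refine ⟨fun β => pointwiseApply (f'.comp β), (ih f' hf').continuousLinearMap_comp _,
      fun β => ?_⟩
    exact hasFDerivAt_comp_left f f'
      (fun x => (hf1.differentiable (by simp) x).hasFDerivAt) β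

lemma contDiff_comp_left (f : C(E, F)) (hf : ContDiff ℝ ∞ f) :
    ContDiff ℝ ∞ (fun β : C(K, E) => f.comp β) :=
  contDiff_infty.2 fun n => contDiff_comp_left_nat n f (hf.of_le (by exact_mod_cast le_top))

/-- The primitive vanishing at `0`, as an operator on continuous functions on `[0, 1]`. -/
def primitive [CompleteSpace E] : C(unitInterval, E) →L[ℝ] C(unitInterval, E) :=
  LinearMap.mkContinuous
    { toFun := fun α => ⟨fun t => ∫ s in (0 : ℝ)..t, Set.IccExtend zero_le_one α s, by
        have h : Continuous (Set.IccExtend (zero_le_one' ℝ) α) := α.continuous.Icc_extend'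
        exact (intervalIntegral.continuous_primitive
          (fun a b => h.intervalIntegrable a b) 0).comp continuous_subtype_val⟩
      map_add' := fun α β => by
        ext t
        exact intervalIntegral.integral_add
          (α.continuous.Icc_extend'.intervalIntegrable _ _)
          (β.continuous.Icc_extend'.intervalIntegrable _ _)
      map_smul' := fun c α => by
        ext t
        exact intervalIntegral.integral_smul c _ } 1
    (fun α => by
      rw [one_mul, ContinuousMap.norm_le _ (norm_nonneg _)]
      intro t
      have h := intervalIntegral.norm_integral_le_of_norm_le_const (a := (0 : ℝ)) (b := t)
        (f := Set.IccExtend (zero_le_one' ℝ) α) (C := ‖α‖) (fun s _ => α.norm_coe_le_norm _)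
      refine h.trans ?_
      rw [sub_zero, abs_of_nonneg t.2.1]
      exact mul_le_of_le_one_right (norm_nonneg _) t.2.2)

lemma primitive_apply [CompleteSpace E] (α : C(unitInterval, E)) (t : unitInterval) :
    primitive α t = ∫ s in (0 : ℝ)..t, Set.IccExtend zero_le_one α s := rfl

end ContinuousMap

end

/-! ### Smooth dependence on initial conditions in Banach spaces -/

noncomputable section
open Set Metric

universe u
variable {E : Type u} [NormedAddCommGroup E] [NormedSpace ℝ E]

/-- The constant functions, as a continuous linear map into the continuous functions. -/
def ContinuousMap.constCLM (K : Type*) [TopologicalSpace K] [CompactSpace K] :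
    E →L[ℝ] C(K, E) :=
  LinearMap.mkContinuous
    { toFun := ContinuousMap.const K
      map_add' := fun _ _ => rfl
      map_smul' := fun _ _ => rfl } 1
    (fun x => by
      rw [one_mul]
      exact (ContinuousMap.norm_le _ (norm_nonneg _)).2 fun _ => le_rfl)

/-- The shear `(τ, β) ↦ (τ, β - τ c)` as a continuous linear equivalence. -/
def ContinuousLinearEquiv.shear {X : Type*} [NormedAddCommGroup X] [NormedSpace ℝ X] (c : X) :
    (ℝ × X) ≃L[ℝ] (ℝ × X) :=
  ContinuousLinearEquiv.equivOfInverse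
    ((ContinuousLinearMap.fst ℝ ℝ X).prod
      (ContinuousLinearMap.snd ℝ ℝ X - (ContinuousLinearMap.fst ℝ ℝ X).smulRight c))
    ((ContinuousLinearMap.fst ℝ ℝ X).prod
      (ContinuousLinearMap.snd ℝ ℝ X + (ContinuousLinearMap.fst ℝ ℝ X).smulRight c))
    (fun p => by ext <;> simp) (fun p => by ext <;> simp)

variable [CompleteSpace E]

/-- The map `(τ, α) ↦ (τ, α - τ ∫₀ f ∘ α)` on `ℝ × C([0, 1], E)`. If `γ`
solves `γ' = f ∘ γ` with `γ 0 = z`, then `(τ, s ↦ γ (τ s))` is mapped to `(τ, z)`, where `z` stands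
for the constant function. -/
def odeMap (f : C(E, E)) (p : ℝ × C(unitInterval, E)) : ℝ × C(unitInterval, E) :=
  (p.1, p.2 - p.1 • ContinuousMap.primitive (f.comp p.2))

lemma contDiff_odeMap (f : C(E, E)) (hf : ContDiff ℝ ∞ f) : ContDiff ℝ ∞ (odeMap f) := by
  have h : ContDiff ℝ ∞ fun p : ℝ × C(unitInterval, E) => f.comp p.2 :=
    (ContinuousMap.contDiff_comp_left f hf).comp contDiff_snd
  exact contDiff_fst.prodMk
    (contDiff_snd.sub (contDiff_fst.smul (h.continuousLinearMap_comp ContinuousMap.primitive)))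

lemma hasFDerivAt_odeMap (f : C(E, E)) (hf : ContDiff ℝ ∞ f) (α : C(unitInterval, E)) :
    HasFDerivAt (odeMap f) (ContinuousLinearEquiv.shear (ContinuousMap.primitive (f.comp α)) :
      (ℝ × C(unitInterval, E)) →L[ℝ] (ℝ × C(unitInterval, E))) (0, α) := by
  have h : ContDiff ℝ ∞ fun p : ℝ × C(unitInterval, E) => ContinuousMap.primitive (f.comp p.2) :=
    ((ContinuousMap.contDiff_comp_left f hf).comp contDiff_snd).continuousLinearMap_comp _
  have h' := (h.differentiable (by simp) (0, α)).hasFDerivAt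
  have h1 := hasFDerivAt_fst (𝕜 := ℝ) (p := ((0 : ℝ), α))
  have h2 := hasFDerivAt_snd (𝕜 := ℝ) (p := ((0 : ℝ), α))
  have := h1.prodMk (h2.sub (h1.smul h'))
  refine this.congr_fderiv ?_
  ext <;> simp [ContinuousLinearEquiv.shear]

/-- Along a solution of `γ' = f ∘ γ`, the rescaled restriction to `[0, τ]` is mapped by `odeMap f`
to the constant curve at the initial value. -/
lemma odeMap_eq_of_hasDerivAt (f : C(E, E)) {γ : ℝ → E} {ε τ : ℝ} (hτ : τ ∈ Ioo (-ε) ε)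
    (hγ : ∀ t ∈ Ioo (-ε) ε, HasDerivAt γ (f (γ t)) t) (β : C(unitInterval, E))
    (hβ : ∀ s, β s = γ (τ * s)) :
    odeMap f (τ, β) = (τ, ContinuousMap.constCLM unitInterval (γ 0)) := by
  refine Prod.ext rfl ?_
  ext s
  change β s - τ • ContinuousMap.primitive (f.comp β) s = γ 0
  have hmem : ∀ σ ∈ Icc (0 : ℝ) 1, τ * σ ∈ Ioo (-ε) ε := fun σ hσ => by
    rw [mem_Ioo, ← abs_lt] at hτ ⊢
    rw [abs_mul, abs_of_nonneg hσ.1]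
    exact (mul_le_of_le_one_right (abs_nonneg _) hσ.2).trans_lt hτ
  have hsub : uIcc (0 : ℝ) s ⊆ Icc 0 1 := by
    rw [uIcc_of_le s.2.1]; exact Icc_subset_Icc_right s.2.2
  have hd : ∀ σ ∈ uIcc (0 : ℝ) s, HasDerivAt (fun σ => γ (τ * σ)) (τ • f (γ (τ * σ))) σ := by
    intro σ hσ
    have h1 : HasDerivAt (fun σ : ℝ => τ * σ) τ σ := by simpa using (hasDerivAt_id σ).const_mul τ
    exact (hγ _ (hmem σ (hsub hσ))).scomp σ h1
  have hcont : ContinuousOn (fun σ => τ • f (γ (τ * σ))) (uIcc (0 : ℝ) s) :=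
    (f.continuous.comp_continuousOn
      fun σ hσ => (hd σ hσ).continuousAt.continuousWithinAt).const_smul τ
  have hint := intervalIntegral.integral_eq_sub_of_hasDerivAt hd hcont.intervalIntegrable
  rw [ContinuousMap.primitive_apply, ← intervalIntegral.integral_smul]
  have hcongr : ∫ σ in (0 : ℝ)..s, τ • IccExtend zero_le_one (f.comp β) σ =
      ∫ σ in (0 : ℝ)..s, τ • f (γ (τ * σ)) := by
    refine intervalIntegral.integral_congr fun σ hσ => ?_
    rw [IccExtend_of_mem zero_le_one _ (hsub hσ), ContinuousMap.comp_apply, hβ]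
  rw [hcongr, hint, hβ]
  simp

/-- **Smooth dependence on initial conditions.** The local flow of a smooth vector field on a
Banach space is jointly smooth in time and initial value. By the inverse function theorem,
`odeMap f` has a smooth local inverse at `(0, z₀)`, and the flow is the value at `1` of the inverse
image of `(τ, z)`. -/
theorem ContDiff.exists_contDiffOn_flow {f : E → E} (hf : ContDiff ℝ ∞ f) (z₀ : E) :
    ∃ r > 0, ∃ ε > 0, ∃ φ : ℝ × E → E, ContDiffOn ℝ ∞ φ (Ioo (-ε) ε ×ˢ ball z₀ r) ∧
      ∀ z ∈ ball z₀ r, φ (0, z) = z ∧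
        ∀ t ∈ Ioo (-ε) ε, HasDerivAt (fun t => φ (t, z)) (f (φ (t, z))) t := by
  let fc : C(E, E) := ⟨f, hf.continuous⟩
  let κ : E →L[ℝ] C(unitInterval, E) := ContinuousMap.constCLM unitInterval
  have hΨ := contDiff_odeMap fc hf
  have hΨ' := hasFDerivAt_odeMap fc hf (κ z₀)
  let P := hΨ.contDiffAt.toOpenPartialHomeomorph (odeMap fc) hΨ' (by simp)
  have hPcoe : ⇑P = odeMap fc := hΨ.contDiffAt.toOpenPartialHomeomorph_coe hΨ' (by simp)
  have hPmem : ((0 : ℝ), κ z₀) ∈ P.source :=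
    hΨ.contDiffAt.mem_toOpenPartialHomeomorph_source hΨ' (by simp)
  -- `P.symm` is smooth at the images of all points where the derivative is invertible, and these
  -- form an open set: smoothness at the single point `(0, κ z₀)` would not give a neighbourhood for
  -- order `∞`.
  let V : Set (ℝ × C(unitInterval, E)) := fderiv ℝ (odeMap fc) ⁻¹'
    range ((↑) : ((ℝ × C(unitInterval, E)) ≃L[ℝ] (ℝ × C(unitInterval, E))) →
      (ℝ × C(unitInterval, E)) →L[ℝ] (ℝ × C(unitInterval, E)))
  have hV : IsOpen V := (ContinuousLinearEquiv.isOpen (𝕜 := ℝ) (E := ℝ × C(unitInterval, E))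
    (F := ℝ × C(unitInterval, E))).preimage
    (hΨ.continuous_fderiv (by simp))
  have hmemV : ((0 : ℝ), κ z₀) ∈ V := ⟨_, hΨ'.fderiv.symm⟩
  have hsymm : ∀ p ∈ P.source ∩ V, ContDiffAt ℝ ∞ P.symm (P p) := by
    rintro p ⟨hp, e, he⟩
    refine P.contDiffAt_symm (f₀' := e) (P.map_source hp) ?_ ?_
    · rw [P.left_inv hp, hPcoe, he]
      exact (hΨ.differentiable (by simp) p).hasFDerivAt
    · rw [hPcoe]; exact hΨ.contDiffAt
  obtain ⟨δ, hδ, hball⟩ := Metric.mem_nhds_iff.1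
    ((P.open_source.inter hV).mem_nhds ⟨hPmem, hmemV⟩)
  -- the solutions themselves, which are only known to be jointly continuous at this stage
  obtain ⟨ε₀, hε₀, a, r₀, _, _, hr₀, hpl⟩ :=
    IsPicardLindelof.of_contDiffAt_one (hf.contDiffAt.of_le (by simp) : ContDiffAt ℝ 1 f z₀)
  obtain ⟨α, hα, hαc⟩ :=
    (hpl 0).exists_forall_mem_closedBall_eq_hasDerivWithinAt_continuousOn
  simp only [zero_sub, zero_add] at hα hαc
  have hr₀' : (0 : ℝ) < r₀ := hr₀
  have hα0 : α (z₀, 0) = z₀ := (hα z₀ (mem_closedBall_self hr₀'.le)).1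
  have hnhds : closedBall z₀ (r₀ : ℝ) ×ˢ Icc (-ε₀) ε₀ ∈ 𝓝 (z₀, (0 : ℝ)) :=
    prod_mem_nhds (closedBall_mem_nhds _ hr₀') (Icc_mem_nhds (by linarith) hε₀)
  have hcα : ContinuousAt α (z₀, 0) := hαc.continuousAt hnhds
  have hev : ∀ᶠ p in 𝓝 (z₀, (0 : ℝ)), α p ∈ ball z₀ (δ / 2) :=
    hcα.eventually (by rw [hα0]; exact ball_mem_nhds _ (by positivity))
  obtain ⟨ρ, hρ, hρball⟩ := Metric.mem_nhds_iff.1 hev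
  let r := min ρ r₀
  let ε := min (min ρ ε₀) δ
  have hr : 0 < r := lt_min hρ hr₀'
  have hε : 0 < ε := lt_min (lt_min hρ hε₀) hδ
  have hεε₀ : Ioo (-ε) ε ⊆ Ioo (-ε₀) ε₀ := by
    have : ε ≤ ε₀ := (min_le_left _ _).trans (min_le_right _ _)
    exact Ioo_subset_Ioo (by linarith) this
  have hzr : ∀ z ∈ ball z₀ r, z ∈ closedBall z₀ (r₀ : ℝ) := fun z hz =>
    ball_subset_closedBall (ball_subset_ball (min_le_right _ _) hz)
  have hαd : ∀ z ∈ ball z₀ r, ∀ t ∈ Ioo (-ε) ε,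
      HasDerivAt (fun t => α (z, t)) (f (α (z, t))) t := fun z hz t ht =>
    ((hα z (hzr z hz)).2 t (Ioo_subset_Icc_self (hεε₀ ht))).hasDerivAt
      (Icc_mem_nhds (hεε₀ ht).1 (hεε₀ ht).2)
  have hclose : ∀ z ∈ ball z₀ r, ∀ t ∈ Ioo (-ε) ε, α (z, t) ∈ ball z₀ (δ / 2) := by
    intro z hz t ht
    refine hρball (?_ : (z, t) ∈ ball (z₀, (0 : ℝ)) ρ)
    rw [mem_ball, Prod.dist_eq]
    refine max_lt (lt_of_lt_of_le hz (min_le_left _ _)) ?_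
    rw [Real.dist_eq, sub_zero, abs_lt]
    have : ε ≤ ρ := (min_le_left _ _).trans (min_le_left _ _)
    exact ⟨by linarith [ht.1], by linarith [ht.2]⟩
  have hmul : ∀ τ ∈ Ioo (-ε) ε, ∀ s : unitInterval, τ * s ∈ Ioo (-ε) ε := by
    intro τ hτ s
    rw [mem_Ioo, ← abs_lt] at hτ ⊢
    rw [abs_mul, abs_of_nonneg s.2.1]
    exact (mul_le_of_le_one_right (abs_nonneg _) s.2.2).trans_lt hτ
  -- near `(0, z₀)` the rescaled solutions lie in the domain where `P` is invertible
  have key : ∀ τ ∈ Ioo (-ε) ε, ∀ z ∈ ball z₀ r, ∃ p ∈ P.source ∩ V,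
      P p = (τ, κ z) ∧ p.2 1 = α (z, τ) := by
    intro τ hτ z hz
    have hcont : Continuous fun s : unitInterval => α (z, τ * s) := by
      rw [continuous_iff_continuousAt]
      intro s
      exact ContinuousAt.comp (g := fun t => α (z, t)) (f := fun s : unitInterval => τ * (s : ℝ))
        (hαd z hz _ (hmul τ hτ s)).continuousAt (by fun_prop)
    let β : C(unitInterval, E) := ⟨fun s => α (z, τ * s), hcont⟩
    have hβ : β ∈ closedBall (κ z₀) (δ / 2) := by
      rw [mem_closedBall, ContinuousMap.dist_le (by positivity)]
      intro s
      exact (mem_ball.1 (hclose z hz _ (hmul τ hτ s))).le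
    refine ⟨(τ, β), hball ?_, ?_, ?_⟩
    · rw [mem_ball, Prod.dist_eq]
      refine max_lt ?_ ((mem_closedBall.1 hβ).trans_lt (by linarith))
      rw [Real.dist_eq, sub_zero, abs_lt]
      have : ε ≤ δ := min_le_right _ _
      exact ⟨by linarith [hτ.1], by linarith [hτ.2]⟩
    · rw [hPcoe, odeMap_eq_of_hasDerivAt fc hτ (fun t ht => hαd z hz t ht) β (fun s => rfl)]
      rw [(hα z (hzr z hz)).1]
    · change α (z, τ * ((1 : unitInterval) : ℝ)) = α (z, τ)
      simp
  refine ⟨r, hr, ε, hε, fun p => α (p.2, p.1), ?_, fun z hz => ⟨(hα z (hzr z hz)).1, hαd z hz⟩⟩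
  let ev : C(unitInterval, E) →L[ℝ] E := ContinuousMap.evalCLM ℝ (1 : unitInterval)
  have hsm : ContDiffOn ℝ ∞ (fun p : ℝ × E => ev (P.symm (p.1, κ p.2)).2)
      (Ioo (-ε) ε ×ˢ ball z₀ r) := by
    rintro ⟨τ, z⟩ ⟨hτ, hz⟩
    obtain ⟨p, hp, hpe, -⟩ := key τ hτ z hz
    have h1 : ContDiffAt ℝ ∞ P.symm (τ, κ z) := hpe ▸ hsymm p hp
    have h2 : ContDiffAt ℝ ∞ (fun p : ℝ × E => (p.1, κ p.2)) (τ, z) :=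
      (contDiff_fst.prodMk (κ.contDiff.comp contDiff_snd)).contDiffAt
    have h3 : ContDiffAt ℝ ∞ (fun p : ℝ × E => P.symm (p.1, κ p.2)) (τ, z) :=
      ContDiffAt.comp (τ, z) (g := P.symm) h1 h2
    exact (ev.contDiff.contDiffAt.comp (τ, z) h3.snd).contDiffWithinAt
  refine hsm.congr ?_
  rintro ⟨τ, z⟩ ⟨hτ, hz⟩
  obtain ⟨p, hp, hpe, hp1⟩ := key τ hτ z hz
  change α (z, τ) = ev (P.symm (τ, κ z)).2
  rw [← hpe, P.left_inv hp.1, ← hp1]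
  rfl

/-- Local version of `ContDiff.exists_contDiffOn_flow`, for a vector field on an open set. -/
theorem ContDiffOn.exists_contDiffOn_flow [HasContDiffBump E] {f : E → E} {S : Set E}
    (hS : IsOpen S) (hf : ContDiffOn ℝ ∞ f S) {z₀ : E} (hz₀ : z₀ ∈ S) :
    ∃ r > 0, ∃ ε > 0, ∃ φ : ℝ × E → E, ContDiffOn ℝ ∞ φ (Ioo (-ε) ε ×ˢ ball z₀ r) ∧
      ∀ z ∈ ball z₀ r, φ (0, z) = z ∧
        ∀ t ∈ Ioo (-ε) ε, φ (t, z) ∈ S ∧ HasDerivAt (fun t => φ (t, z)) (f (φ (t, z))) t := by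
  obtain ⟨R, hR, hRS⟩ := Metric.isOpen_iff.1 hS z₀ hz₀
  let χ : ContDiffBump z₀ := ⟨R / 3, R / 2, by linarith, by linarith⟩
  have hg : ContDiff ℝ ∞ fun z => χ z • f z := by
    rw [contDiff_iff_contDiffAt]
    intro z
    by_cases hz : z ∈ S
    · exact χ.contDiffAt.smul (hf.contDiffAt (hS.mem_nhds hz))
    · have hz' : z ∉ tsupport χ := fun h => hz (hRS (by
        rw [χ.tsupport_eq] at h
        exact closedBall_subset_ball (by change R / 2 < R; linarith) h))
      have h0 : (fun z => χ z • f z) =ᶠ[𝓝 z] fun _ => 0 := by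
        filter_upwards [notMem_tsupport_iff_eventuallyEq.1 hz'] with w hw
        simp [hw]
      exact contDiffAt_const.congr_of_eventuallyEq h0
  obtain ⟨r, hr, ε, hε, φ, hφ, hφ'⟩ := hg.exists_contDiffOn_flow z₀
  have hφ0 : φ (0, z₀) = z₀ := (hφ' z₀ (mem_ball_self hr)).1
  have hc : ContinuousAt φ (0, z₀) := hφ.continuousOn.continuousAt
    (prod_mem_nhds (Ioo_mem_nhds (by linarith) hε) (ball_mem_nhds _ hr))
  have hev : ∀ᶠ p in 𝓝 ((0 : ℝ), z₀), φ p ∈ ball z₀ (R / 3) :=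
    hc.eventually (by rw [hφ0]; exact ball_mem_nhds _ (by positivity))
  obtain ⟨ρ, hρ, hρball⟩ := Metric.mem_nhds_iff.1 hev
  have hmem : ∀ t ∈ Ioo (-min ρ ε) (min ρ ε), ∀ z ∈ ball z₀ (min ρ r),
      φ (t, z) ∈ ball z₀ (R / 3) := by
    intro t ht z hz
    refine hρball (?_ : (t, z) ∈ ball ((0 : ℝ), z₀) ρ)
    rw [mem_ball, Prod.dist_eq]
    refine max_lt ?_ (lt_of_lt_of_le hz (min_le_left _ _))
    rw [Real.dist_eq, sub_zero]
    exact (abs_lt.2 ht).trans_le (min_le_left _ _)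
  have hsubt : Ioo (-min ρ ε) (min ρ ε) ⊆ Ioo (-ε) ε :=
    Ioo_subset_Ioo (neg_le_neg (min_le_right _ _)) (min_le_right _ _)
  have hsubz : ball z₀ (min ρ r) ⊆ ball z₀ r := ball_subset_ball (min_le_right _ _)
  refine ⟨min ρ r, lt_min hρ hr, min ρ ε, lt_min hρ hε, φ, hφ.mono (prod_mono hsubt hsubz),
    fun z hz => ⟨(hφ' z (hsubz hz)).1, fun t ht => ⟨?_, ?_⟩⟩⟩
  · exact hRS (ball_subset_ball (by linarith) (hmem t ht z hz))
  · have h := (hφ' z (hsubz hz)).2 t (hsubt ht)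
    rwa [χ.one_of_mem_closedBall (ball_subset_closedBall (hmem t ht z hz)), one_smul] at h

end

/-! ### Velocities of curves and local flows on manifolds -/

noncomputable section
open Set Metric

section Tangent
variable {E H N E' H' N' E'' H'' P : Type*}
  [NormedAddCommGroup E] [NormedSpace ℝ E] [TopologicalSpace H] {I : ModelWithCorners ℝ E H}
  [TopologicalSpace N] [ChartedSpace H N] [IsManifold I ∞ N]
  [NormedAddCommGroup E'] [NormedSpace ℝ E'] [TopologicalSpace H'] {I' : ModelWithCorners ℝ E' H'}
  [TopologicalSpace N'] [ChartedSpace H' N'] [IsManifold I' ∞ N']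
  [NormedAddCommGroup E''] [NormedSpace ℝ E''] [TopologicalSpace H'']
  {J : ModelWithCorners ℝ E'' H''} [TopologicalSpace P] [ChartedSpace H'' P]

/-- The differential of a smooth map applied to a smooth family of tangent vectors, parametrized by
a third manifold, is a smooth family of tangent vectors. -/
lemma ContMDiffOn.contMDiffAt_tangentMap_comp {h : N → N'} {O : Set N} (hO : IsOpen O)
    (hh : ContMDiffOn I I' ∞ h O) {σ : P → TangentBundle I N} {p : P}
    (hσ : ContMDiffAt J I.tangent ∞ σ p) (hp : (σ p).1 ∈ O) :
    ContMDiffAt J I'.tangent ∞ (fun q => tangentMap I I' h (σ q)) p := by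
  have h1 := hh.contMDiffOn_tangentMapWithin (m := ∞) (by simp) hO.uniqueMDiffOn
  have hcont : Continuous (Bundle.TotalSpace.proj : TangentBundle I N → N) :=
    FiberBundle.continuous_proj E (TangentSpace I)
  have hO' : IsOpen (Bundle.TotalSpace.proj ⁻¹' O : Set (TangentBundle I N)) := hO.preimage hcont
  have h2 := (h1.contMDiffAt (hO'.mem_nhds hp)).comp p hσ
  refine h2.congr_of_eventuallyEq ?_
  filter_upwards [hσ.continuousAt.preimage_mem_nhds (hO'.mem_nhds hp)] with q hq
  exact (tangentMapWithin_eq_tangentMap (hO.uniqueMDiffOn _ hq)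
    ((hh.contMDiffAt (hO.mem_nhds hq)).mdifferentiableAt (by simp))).symm

end Tangent

section Curve
variable {E H N E' H' N' : Type*}
  [NormedAddCommGroup E] [NormedSpace ℝ E] [TopologicalSpace H] {I : ModelWithCorners ℝ E H}
  [TopologicalSpace N] [ChartedSpace H N]
  [NormedAddCommGroup E'] [NormedSpace ℝ E'] [TopologicalSpace H'] {I' : ModelWithCorners ℝ E' H'}
  [TopologicalSpace N'] [ChartedSpace H' N']

/-- The curve `γ` has velocity `w` at time `t`. The vector `w` is typed in the model space, to which
all tangent spaces are equal by definition, so that velocities at points which are only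
propositionally equal can be compared. -/
def HasVelocityAt (I : ModelWithCorners ℝ E H) (γ : ℝ → N) (t : ℝ)
    (w : E) : Prop :=
  HasMFDerivAt 𝓘(ℝ, ℝ) I γ t ((1 : ℝ →L[ℝ] ℝ).smulRight (w : TangentSpace I (γ t)))

lemma HasVelocityAt.comp_within {γ : ℝ → N} {t : ℝ} {w : E} {h : N → N'}
    {S : Set N} {A : TangentSpace I (γ t) →L[ℝ] TangentSpace I' (h (γ t))}
    (hh : HasMFDerivWithinAt I I' h S (γ t) A) (hγ : HasVelocityAt I γ t w)
    (hS : ∀ᶠ s in 𝓝 t, γ s ∈ S) : HasVelocityAt I' (fun s => h (γ s)) t (A w) := by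
  have h1 := (HasMFDerivWithinAt.comp (s := γ ⁻¹' S) t hh
    (HasMFDerivAt.hasMFDerivWithinAt hγ) subset_rfl).hasMFDerivAt hS
  refine h1.congr_mfderiv (ContinuousLinearMap.ext_ring ?_)
  change A ((1 : ℝ) • w) = (1 : ℝ) • A w
  rw [one_smul, one_smul]

lemma HasVelocityAt.comp {γ : ℝ → N} {t : ℝ} {w : E} {h : N → N'}
    {A : TangentSpace I (γ t) →L[ℝ] TangentSpace I' (h (γ t))}
    (hh : HasMFDerivAt I I' h (γ t) A) (hγ : HasVelocityAt I γ t w) :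
    HasVelocityAt I' (fun s => h (γ s)) t (A w) :=
  HasVelocityAt.comp_within hh.hasMFDerivWithinAt hγ
    (Filter.Eventually.of_forall fun _ => mem_univ _)

lemma HasVelocityAt.unique {γ : ℝ → N} {t : ℝ} {w w' : E}
    (h : HasVelocityAt I γ t w) (h' : HasVelocityAt I γ t w') : w = w' := by
  have := DFunLike.congr_fun (hasMFDerivAt_unique h h') (1 : ℝ)
  change (1 : ℝ) • w = (1 : ℝ) • w' at this
  rwa [one_smul, one_smul] at this

lemma HasVelocityAt.congr {γ γ' : ℝ → N} {t : ℝ} {w : E}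
    (h : HasVelocityAt I γ t w) (h' : γ' =ᶠ[𝓝 t] γ) :
    HasVelocityAt I γ' t w := by
  have h1 : HasMFDerivAt 𝓘(ℝ, ℝ) I γ t
      ((1 : ℝ →L[ℝ] ℝ).smulRight (w : TangentSpace I (γ t))) := h
  exact h1.congr_of_eventuallyEq h'

lemma hasVelocityAt_iff_hasDerivAt {γ : ℝ → E} {t : ℝ} {w : E} :
    HasVelocityAt 𝓘(ℝ, E) γ t w ↔ HasDerivAt γ w t :=
  Iff.trans hasMFDerivAt_iff_hasFDerivAt (by
    rw [hasDerivAt_iff_hasFDerivAt, ← ContinuousLinearMap.smulRight_one_eq_toSpanSingleton]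
    rfl)

lemma IsMIntegralCurveOn.hasVelocityAt {γ : ℝ → N} {v : ∀ x : N, TangentSpace I x} {s : Set ℝ}
    (h : IsMIntegralCurveOn γ v s) {t : ℝ} (ht : s ∈ 𝓝 t) : HasVelocityAt I γ t (v (γ t)) :=
  (h t (mem_of_mem_nhds ht)).hasMFDerivAt ht

lemma isMIntegralCurveOn_of_hasVelocityAt {γ : ℝ → N} {v : ∀ x : N, TangentSpace I x} {s : Set ℝ}
    (h : ∀ t ∈ s, HasVelocityAt I γ t (v (γ t))) : IsMIntegralCurveOn γ v s :=
  fun t ht => (h t ht).hasMFDerivWithinAt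

end Curve

section Flow
variable {E H N : Type*}
  [NormedAddCommGroup E] [NormedSpace ℝ E] [CompleteSpace E] [HasContDiffBump E]
  [TopologicalSpace H] {I : ModelWithCorners ℝ E H} [I.Boundaryless]
  [TopologicalSpace N] [ChartedSpace H N] [IsManifold I ∞ N]

/-- A smooth vector field on a manifold without boundary has local flows which are jointly smooth
in time and initial point. -/
theorem exists_contMDiffOn_localFlow {v : ∀ x : N, TangentSpace I x}
    (hv : ContMDiff I I.tangent ∞ (fun x => (⟨x, v x⟩ : TangentBundle I N))) (x₀ : N) :
    ∃ O : Set N, IsOpen O ∧ x₀ ∈ O ∧ ∃ ε > 0, ∃ Φ : ℝ × N → N,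
      ContMDiffOn (𝓘(ℝ, ℝ).prod I) I ∞ Φ (Ioo (-ε) ε ×ˢ O) ∧
      ∀ x ∈ O, Φ (0, x) = x ∧ IsMIntegralCurveOn (fun t => Φ (t, x)) v (Ioo (-ε) ε) := by
  let e := extChartAt I x₀
  have he : ContMDiffOn I 𝓘(ℝ, E) ∞ e e.source := by
    rw [extChartAt_source]; exact contMDiffOn_extChartAt
  have hes : ContMDiffOn 𝓘(ℝ, E) I ∞ e.symm e.target := contMDiffOn_extChartAt_symm x₀
  have hsrc : IsOpen e.source := isOpen_extChartAt_source x₀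
  have htgt : IsOpen e.target := isOpen_extChartAt_target x₀
  let f : E → E := fun z => (tangentMap I 𝓘(ℝ, E) e ⟨e.symm z, v (e.symm z)⟩).2
  have hf : ContDiffOn ℝ ∞ f e.target := by
    rw [← contMDiffOn_iff_contDiffOn]
    intro z hz
    have h1 : ContMDiffAt 𝓘(ℝ, E) I.tangent ∞
        (fun z => (⟨e.symm z, v (e.symm z)⟩ : TangentBundle I N)) z :=
      hv.contMDiffAt.comp z (hes.contMDiffAt (htgt.mem_nhds hz))
    have h2 := he.contMDiffAt_tangentMap_comp hsrc h1 (e.map_target hz)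
    exact ((contMDiff_snd_tangentBundle_modelSpace E 𝓘(ℝ, E)).contMDiffAt.comp z
      h2).contMDiffWithinAt
  obtain ⟨r, hr, ε, hε, φ, hφ, hφ'⟩ :=
    hf.exists_contDiffOn_flow htgt (mem_extChartAt_target (I := I) x₀)
  let O : Set N := e.source ∩ e ⁻¹' ball (e x₀) r
  have hO : IsOpen O := (continuousOn_extChartAt x₀).isOpen_inter_preimage hsrc isOpen_ball
  refine ⟨O, hO, ⟨mem_extChartAt_source x₀, mem_ball_self hr⟩, ε, hε,
    fun p => e.symm (φ (p.1, e p.2)), ?_, ?_⟩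
  · rintro ⟨t, x⟩ ⟨ht, hx⟩
    have hφt : φ (t, e x) ∈ e.target := ((hφ' _ hx.2).2 t ht).1
    have h1 : ContMDiffAt (𝓘(ℝ, ℝ).prod I) 𝓘(ℝ, ℝ × E) ∞ (fun p : ℝ × N => (p.1, e p.2)) (t, x) :=
      contMDiffAt_fst.prodMk_space
        ((he.contMDiffAt (hsrc.mem_nhds hx.1)).comp (t, x) contMDiffAt_snd)
    have h2 : ContMDiffAt 𝓘(ℝ, ℝ × E) 𝓘(ℝ, E) ∞ φ (t, e x) :=
      (hφ.contDiffAt (prod_mem_nhds (isOpen_Ioo.mem_nhds ht)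
        (isOpen_ball.mem_nhds hx.2))).contMDiffAt
    have h3 := ContMDiffAt.comp (t, x) (g := φ) h2 h1
    exact (ContMDiffAt.comp (t, x) (g := e.symm) (hes.contMDiffAt (htgt.mem_nhds hφt))
      h3).contMDiffWithinAt
  · rintro x ⟨hx, hxr⟩
    refine ⟨by simp only; rw [(hφ' _ hxr).1, e.left_inv hx], fun t ht => ?_⟩
    obtain ⟨hφt, hd⟩ := (hφ' _ hxr).2 t ht
    have h1 : HasVelocityAt 𝓘(ℝ, E) (fun t => φ (t, e x)) t (f (φ (t, e x))) :=
      hasVelocityAt_iff_hasDerivAt.2 hd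
    have h2 := ((hes.contMDiffAt (htgt.mem_nhds hφt)).mdifferentiableAt (by simp)).hasMFDerivAt
    have h3 := HasVelocityAt.comp h2 h1
    have hcomp : (mfderiv 𝓘(ℝ, E) I e.symm (φ (t, e x))).comp
        (mfderiv I 𝓘(ℝ, E) e (e.symm (φ (t, e x)))) =
        ContinuousLinearMap.id ℝ (TangentSpace I (e.symm (φ (t, e x)))) := by
      have := mfderivWithin_extChartAt_symm_comp_mfderiv_extChartAt hφt
      rwa [I.range_eq_univ, mfderivWithin_univ] at this
    have h4 := DFunLike.congr_fun hcomp (v (e.symm (φ (t, e x))))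
    have h5 : mfderiv 𝓘(ℝ, E) I e.symm (φ (t, e x)) (f (φ (t, e x))) =
      v (e.symm (φ (t, e x))) := h4
    rw [h5] at h3
    exact h3.hasMFDerivWithinAt

end Flow

end

/-! ### Fibre charts and left invariant vector fields -/

noncomputable section
open Set Metric

namespace LieGroupoid

universe u
variable {E : Type*} {F : Type u} {M G : Type*}
  [NormedAddCommGroup E] [NormedSpace ℝ E] [NormedAddCommGroup F] [NormedSpace ℝ F]
  [TopologicalSpace M] [ChartedSpace E M] [TopologicalSpace G] [ChartedSpace F G]

lemma contMDiff_source (𝒢 : LieGroupoid E F M G) [IsManifold 𝓘(ℝ, F) ∞ G]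
    [IsManifold 𝓘(ℝ, E) ∞ M] : ContMDiff 𝓘(ℝ, F) 𝓘(ℝ, E) ∞ 𝒢.source :=
  𝒢.isSubmersion_source.contMDiff

lemma contMDiff_target (𝒢 : LieGroupoid E F M G) [IsManifold 𝓘(ℝ, F) ∞ G]
    [IsManifold 𝓘(ℝ, E) ∞ M] : ContMDiff 𝓘(ℝ, F) 𝓘(ℝ, E) ∞ 𝒢.target :=
  𝒢.isSubmersion_target.contMDiff

/-- A local trivialization of the source map: the open set `dom` of arrows is identified with the
open subset `cod` of `M × W` by `g ↦ (source g, fib g)`, with inverse `arr`. -/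
structure FibreChart (𝒢 : LieGroupoid E F M G) (W : Type*) [NormedAddCommGroup W]
    [NormedSpace ℝ W] where
  /-- the domain -/
  dom : Set G
  /-- the image -/
  cod : Set (M × W)
  /-- the coordinate along the source fibres -/
  fib : G → W
  /-- the inverse -/
  arr : M × W → G
  isOpen_dom : IsOpen dom
  isOpen_cod : IsOpen cod
  contMDiffOn_fib : ContMDiffOn 𝓘(ℝ, F) 𝓘(ℝ, W) ∞ fib dom
  contMDiffOn_arr : ContMDiffOn (𝓘(ℝ, E).prod 𝓘(ℝ, W)) 𝓘(ℝ, F) ∞ arr cod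
  mem_cod : ∀ g ∈ dom, (𝒢.source g, fib g) ∈ cod
  arr_fib : ∀ g ∈ dom, arr (𝒢.source g, fib g) = g
  arr_mem : ∀ p ∈ cod, arr p ∈ dom
  source_arr : ∀ p ∈ cod, 𝒢.source (arr p) = p.1
  fib_arr : ∀ p ∈ cod, fib (arr p) = p.2

variable [IsManifold 𝓘(ℝ, E) ∞ M] [IsManifold 𝓘(ℝ, F) ∞ G]

lemma exists_fibreChart (𝒢 : LieGroupoid E F M G) [FiniteDimensional ℝ F] (g₀ : G) :
    ∃ (W : Type u) (_ : NormedAddCommGroup W) (_ : NormedSpace ℝ W) (_ : FiniteDimensional ℝ W)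
      (c : 𝒢.FibreChart W), g₀ ∈ c.dom := by
  obtain ⟨W, _, _, h⟩ := 𝒢.isSubmersion_source.isSubmersionAt g₀
  let φ := h.domChart
  let ψ := h.codChart
  let L := h.equiv
  have hfin : FiniteDimensional ℝ W :=
    Module.Finite.of_surjective ((LinearMap.snd ℝ E W).comp L.toLinearEquiv.toLinearMap)
      (Prod.snd_surjective.comp L.surjective)
  have hw : ∀ g ∈ φ.source, ψ (𝒢.source g) = (L (φ g)).1 := by
    intro g hg
    have hmem : φ g ∈ (h.domChart.extend 𝓘(ℝ, F)).target := by simpa using φ.map_source hg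
    have h1 := h.writtenInCharts hmem
    have h2 : h.domChart.symm (φ g) = g := φ.left_inv hg
    simpa [h2] using h1
  have hsrc : ∀ g ∈ φ.source, 𝒢.source g ∈ ψ.source := h.source_subset_preimage_source
  have hφ : ContMDiffOn 𝓘(ℝ, F) 𝓘(ℝ, F) ∞ φ φ.source :=
    contMDiffOn_of_mem_maximalAtlas h.domChart_mem_maximalAtlas
  have hφs : ContMDiffOn 𝓘(ℝ, F) 𝓘(ℝ, F) ∞ φ.symm φ.target :=
    contMDiffOn_symm_of_mem_maximalAtlas h.domChart_mem_maximalAtlas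
  have hψ : ContMDiffOn 𝓘(ℝ, E) 𝓘(ℝ, E) ∞ ψ ψ.source :=
    contMDiffOn_of_mem_maximalAtlas h.codChart_mem_maximalAtlas
  let κ : M × W → F := fun p => L.symm (ψ p.1, p.2)
  have hκ : ContMDiffOn (𝓘(ℝ, E).prod 𝓘(ℝ, W)) 𝓘(ℝ, F) ∞ κ (ψ.source ×ˢ univ) := by
    have h1 : ContMDiffOn (𝓘(ℝ, E).prod 𝓘(ℝ, W)) 𝓘(ℝ, E × W) ∞ (fun p : M × W => (ψ p.1, p.2))
        (ψ.source ×ˢ univ) :=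
      (hψ.comp contMDiffOn_fst fun p hp => hp.1).prodMk_space contMDiffOn_snd
    exact L.symm.contDiff.contMDiff.comp_contMDiffOn h1
  refine ⟨W, _, _, hfin,
    { dom := φ.source
      cod := (ψ.source ×ˢ univ) ∩ κ ⁻¹' φ.target
      fib := fun g => (L (φ g)).2
      arr := fun p => φ.symm (κ p)
      isOpen_dom := φ.open_source
      isOpen_cod := hκ.continuousOn.isOpen_inter_preimage (ψ.open_source.prod isOpen_univ)
        φ.open_target
      contMDiffOn_fib :=
        (contDiff_snd.comp L.contDiff).contMDiff.comp_contMDiffOn hφ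
      contMDiffOn_arr := hφs.comp (hκ.mono inter_subset_left) inter_subset_right
      mem_cod := ?_
      arr_fib := ?_
      arr_mem := fun p hp => φ.map_target hp.2
      source_arr := ?_
      fib_arr := ?_ }, h.mem_domChart_source⟩
  · intro g hg
    refine ⟨⟨hsrc g hg, mem_univ _⟩, ?_⟩
    have : κ (𝒢.source g, (L (φ g)).2) = φ g := by
      simp only [κ]; rw [hw g hg]; exact L.symm_apply_apply _
    rw [mem_preimage, this]
    exact φ.map_source hg
  · intro g hg
    have : κ (𝒢.source g, (L (φ g)).2) = φ g := by
      simp only [κ]; rw [hw g hg]; exact L.symm_apply_apply _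
    rw [this, φ.left_inv hg]
  · intro p hp
    have hmem := φ.map_target hp.2
    refine ψ.injOn (hsrc _ hmem) hp.1.1 ?_
    rw [hw _ hmem, φ.right_inv hp.2]
    simp [κ]
  · intro p hp
    rw [φ.right_inv hp.2]
    simp [κ]

variable {𝒢 : LieGroupoid E F M G} {W : Type*} [NormedAddCommGroup W] [NormedSpace ℝ W]

/-- A vector tangent to a source fibre is recovered from its coordinate. -/
lemma FibreChart.mfderiv_arr (c : 𝒢.FibreChart W) {g : G} (hg : g ∈ c.dom)
    (w : TangentSpace 𝓘(ℝ, F) g) (hw : mfderiv 𝓘(ℝ, F) 𝓘(ℝ, E) 𝒢.source g w = 0) :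
    (mfderiv (𝓘(ℝ, E).prod 𝓘(ℝ, W)) 𝓘(ℝ, F) c.arr (𝒢.source g, c.fib g)
      ((0, mfderiv 𝓘(ℝ, F) 𝓘(ℝ, W) c.fib g w) : E × W) : F) = w := by
  have h1 := ((𝒢.contMDiff_source g).mdifferentiableAt (by simp)).hasMFDerivAt
  have h2 := ((c.contMDiffOn_fib.contMDiffAt (c.isOpen_dom.mem_nhds hg)).mdifferentiableAt
    (by simp)).hasMFDerivAt
  have h3 := ((c.contMDiffOn_arr.contMDiffAt
    (c.isOpen_cod.mem_nhds (c.mem_cod g hg))).mdifferentiableAt (by simp)).hasMFDerivAt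
  have h4 := HasMFDerivAt.comp (f := fun g => (𝒢.source g, c.fib g)) g h3 (h1.prodMk h2)
  have h5 : HasMFDerivAt 𝓘(ℝ, F) 𝓘(ℝ, F) (c.arr ∘ fun g => (𝒢.source g, c.fib g)) g
      (ContinuousLinearMap.id ℝ F) := by
    refine (hasMFDerivAt_id (I := 𝓘(ℝ, F)) g).congr_of_eventuallyEq ?_
    filter_upwards [c.isOpen_dom.mem_nhds hg] with g' hg'
    exact c.arr_fib g' hg'
  have h6 := DFunLike.congr_fun (hasMFDerivAt_unique h4 h5) w
  change (mfderiv (𝓘(ℝ, E).prod 𝓘(ℝ, W)) 𝓘(ℝ, F) c.arr (𝒢.source g, c.fib g)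
      ((mfderiv 𝓘(ℝ, F) 𝓘(ℝ, E) 𝒢.source g w, mfderiv 𝓘(ℝ, F) 𝓘(ℝ, W) c.fib g w) : E × W) : F)
      = w at h6
  rw [hw] at h6
  exact h6

/-- The curve in the source fibre through `g` which is affine in the coordinate of a fibre chart. -/
def FibreChart.curve (c : 𝒢.FibreChart W) (y : M) (w ξ : W) (t : ℝ) : G :=
  c.arr (y, w + t • ξ)

lemma FibreChart.hasVelocityAt_curve (c : 𝒢.FibreChart W) {y : M} {w : W} (h : (y, w) ∈ c.cod)
    (ξ : W) : HasVelocityAt 𝓘(ℝ, F) (c.curve y w ξ) 0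
      (mfderiv (𝓘(ℝ, E).prod 𝓘(ℝ, W)) 𝓘(ℝ, F) c.arr (y, w) ((0, ξ) : E × W) : F) := by
  have h1 : HasVelocityAt 𝓘(ℝ, W) (fun t : ℝ => w + t • ξ) 0 ξ := by
    rw [hasVelocityAt_iff_hasDerivAt]
    simpa using ((hasDerivAt_id (0 : ℝ)).smul_const ξ).const_add w
  have h2 : HasVelocityAt (𝓘(ℝ, E).prod 𝓘(ℝ, W)) (fun t : ℝ => (y, w + t • ξ)) 0
      ((0, ξ) : E × W) := by
    have := HasMFDerivAt.prodMk (hasMFDerivAt_const (I := 𝓘(ℝ, ℝ)) (I' := 𝓘(ℝ, E)) y (0 : ℝ)) h1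
    refine this.congr_mfderiv (ContinuousLinearMap.ext_ring ?_)
    change ((0 : E), (1 : ℝ) • ξ) = (1 : ℝ) • ((0 : E), ξ)
    simp
  have hw : (y, w + (0 : ℝ) • ξ) = (y, w) := by simp
  have h3 := ((c.contMDiffOn_arr.contMDiffAt
    (c.isOpen_cod.mem_nhds h)).mdifferentiableAt (by simp)).hasMFDerivAt
  rw [← hw] at h3
  have h4 := HasVelocityAt.comp h3 h2
  rw [hw] at h4
  exact h4

lemma FibreChart.source_curve (c : 𝒢.FibreChart W) {y : M} {w : W} (h : (y, w) ∈ c.cod)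
    (ξ : W) : ∀ᶠ t in 𝓝 0, 𝒢.source (c.curve y w ξ t) = y := by
  have hc : Continuous fun t : ℝ => (y, w + t • ξ) := by fun_prop
  filter_upwards [hc.continuousAt.preimage_mem_nhds (c.isOpen_cod.mem_nhds
    (by simpa using h : (y, w + (0 : ℝ) • ξ) ∈ c.cod))] with t ht
  exact c.source_arr _ ht

lemma mdifferentiableWithinAt_mul (𝒢 : LieGroupoid E F M G) {g h : G}
    (hgh : 𝒢.source h = 𝒢.target g) :
    MDifferentiableWithinAt 𝓘(ℝ, F) 𝓘(ℝ, F) (fun h => 𝒢.mul g h)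
      (𝒢.sourceFiber (𝒢.target g)) h := by
  have h1 := 𝒢.contMDiffOn_mul (g, h) hgh.symm
  have h2 : ContMDiffWithinAt 𝓘(ℝ, F) (𝓘(ℝ, F).prod 𝓘(ℝ, F)) ∞ (fun h : G => (g, h))
      (𝒢.sourceFiber (𝒢.target g)) h :=
    contMDiffWithinAt_const.prodMk contMDiffWithinAt_id
  exact (ContMDiffWithinAt.comp h h1 h2 fun k hk => Eq.symm hk).mdifferentiableWithinAt (by simp)

/-- The source fibre is not a set of unique differentiability in `G`, so that the derivative of
`h ↦ g h` within it involves a choice; on velocities of curves in the fibre its value is determined,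
by the velocity of the translated curve. -/
lemma hasVelocityAt_mul (𝒢 : LieGroupoid E F M G) (g h : G) {γ : ℝ → G} {t : ℝ} {w : F}
    (hγ : HasVelocityAt 𝓘(ℝ, F) γ t w) (ht : γ t = h)
    (hs : ∀ᶠ s in 𝓝 t, 𝒢.source (γ s) = 𝒢.target g) :
    HasVelocityAt 𝓘(ℝ, F) (fun s => 𝒢.mul g (γ s)) t
      (mfderivWithin 𝓘(ℝ, F) 𝓘(ℝ, F) (fun h => 𝒢.mul g h)
        (𝒢.sourceFiber (𝒢.target g)) h w : F) := by
  subst ht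
  exact HasVelocityAt.comp_within
    (𝒢.mdifferentiableWithinAt_mul hs.self_of_nhds).hasMFDerivWithinAt hγ hs

namespace AlgebroidSection

lemma leftInvariant_eq (X : 𝒢.AlgebroidSection) (g : G) :
    (X.leftInvariant g : F) = (mfderivWithin 𝓘(ℝ, F) 𝓘(ℝ, F) (fun h => 𝒢.mul g h)
      (𝒢.sourceFiber (𝒢.target g)) (𝒢.unit (𝒢.target g)) (X.val (𝒢.target g)) : F) := rfl

/-- The left invariant vector field is the velocity of `t ↦ g c(t)` for curves `c` in the source
fibre with velocity `X`. -/
lemma hasVelocityAt_leftInvariant (X : 𝒢.AlgebroidSection) (g : G) {γ : ℝ → G}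
    (hγ : HasVelocityAt 𝓘(ℝ, F) γ 0 (X.val (𝒢.target g))) (h0 : γ 0 = 𝒢.unit (𝒢.target g))
    (hs : ∀ᶠ s in 𝓝 0, 𝒢.source (γ s) = 𝒢.target g) :
    HasVelocityAt 𝓘(ℝ, F) (fun s => 𝒢.mul g (γ s)) 0 (X.leftInvariant g) :=
  𝒢.hasVelocityAt_mul g _ hγ h0 hs

/-- The coordinate of a section in a fibre chart. -/
def coord (X : 𝒢.AlgebroidSection) (c : 𝒢.FibreChart W) (y : M) : W :=
  mfderiv 𝓘(ℝ, F) 𝓘(ℝ, W) c.fib (𝒢.unit y) (X.val y)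

lemma mem_cod_unit (c : 𝒢.FibreChart W) {y : M} (hy : 𝒢.unit y ∈ c.dom) :
    (y, c.fib (𝒢.unit y)) ∈ c.cod := by
  have := c.mem_cod _ hy
  rwa [𝒢.source_unit] at this

lemma hasVelocityAt_curve (X : 𝒢.AlgebroidSection) (c : 𝒢.FibreChart W) {y : M}
    (hy : 𝒢.unit y ∈ c.dom) :
    HasVelocityAt 𝓘(ℝ, F) (c.curve y (c.fib (𝒢.unit y)) (X.coord c y)) 0 (X.val y) := by
  have h := c.hasVelocityAt_curve (mem_cod_unit c hy) (X.coord c y)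
  have h2 := c.mfderiv_arr hy (X.val y) (X.mfderiv_source y)
  rw [𝒢.source_unit] at h2
  exact h2 ▸ h

lemma curve_zero (c : 𝒢.FibreChart W) {y : M} (hy : 𝒢.unit y ∈ c.dom) (ξ : W) :
    c.curve y (c.fib (𝒢.unit y)) ξ 0 = 𝒢.unit y := by
  have := c.arr_fib _ hy
  rw [𝒢.source_unit] at this
  simpa [FibreChart.curve] using this

/-- Every section is the velocity of curves in the source fibres. -/
lemma exists_curve [FiniteDimensional ℝ F] (X : 𝒢.AlgebroidSection) (y : M) :
    ∃ γ : ℝ → G, HasVelocityAt 𝓘(ℝ, F) γ 0 (X.val y) ∧ γ 0 = 𝒢.unit y ∧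
      ∀ᶠ s in 𝓝 0, 𝒢.source (γ s) = y := by
  obtain ⟨W, _, _, _, c, hc⟩ := 𝒢.exists_fibreChart (𝒢.unit y)
  exact ⟨_, X.hasVelocityAt_curve c hc, curve_zero c hc _, c.source_curve (mem_cod_unit c hc) _⟩

/-- Left invariance: translation by `g` maps the value at `h` to the value at `g h`. -/
lemma leftInvariant_mul [FiniteDimensional ℝ F] (X : 𝒢.AlgebroidSection) {g h : G}
    (hgh : 𝒢.target g = 𝒢.source h) :
    (X.leftInvariant (𝒢.mul g h) : F) = (mfderivWithin 𝓘(ℝ, F) 𝓘(ℝ, F) (fun h => 𝒢.mul g h)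
      (𝒢.sourceFiber (𝒢.target g)) h (X.leftInvariant h) : F) := by
  obtain ⟨γ, hγ, h0, hs⟩ := X.exists_curve (𝒢.target h)
  have h1 := X.hasVelocityAt_leftInvariant h hγ h0 hs
  have hs1 : ∀ᶠ s in 𝓝 0, 𝒢.source (𝒢.mul h (γ s)) = 𝒢.target g := by
    filter_upwards [hs] with s hs
    rw [𝒢.source_mul _ _ hs.symm, hgh]
  have h2 := 𝒢.hasVelocityAt_mul g h h1 (by rw [h0, 𝒢.mul_unit]) hs1
  have htm : 𝒢.target (𝒢.mul g h) = 𝒢.target h := 𝒢.target_mul g h hgh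
  have h3 := X.hasVelocityAt_leftInvariant (𝒢.mul g h) (γ := γ) (by rw [htm]; exact hγ)
    (by rw [htm]; exact h0) (by rw [htm]; exact hs)
  refine h3.unique (h2.congr ?_)
  filter_upwards [hs] with s hs
  exact (𝒢.mul_assoc g h (γ s) hgh hs.symm).symm

lemma contMDiffAt_coord (X : 𝒢.AlgebroidSection) (c : 𝒢.FibreChart W) {y : M}
    (hy : 𝒢.unit y ∈ c.dom) : ContMDiffAt 𝓘(ℝ, E) 𝓘(ℝ, W) ∞ (X.coord c) y :=
  (contMDiff_snd_tangentBundle_modelSpace W 𝓘(ℝ, W)).contMDiffAt.comp y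
    (c.contMDiffOn_fib.contMDiffAt_tangentMap_comp c.isOpen_dom X.contMDiff.contMDiffAt hy)

/-- Left invariant vector fields are smooth: near `g₀`, in a fibre chart at `1_{β g₀}`, the field
is the derivative at `t = 0` of a smooth map of `(g, t)`. -/
lemma contMDiff_leftInvariant [FiniteDimensional ℝ F] (X : 𝒢.AlgebroidSection) :
    ContMDiff 𝓘(ℝ, F) 𝓘(ℝ, F).tangent ∞
      (fun g => (⟨g, X.leftInvariant g⟩ : TangentBundle 𝓘(ℝ, F) G)) := by
  intro g₀
  obtain ⟨W, _, _, _, c, hc⟩ := 𝒢.exists_fibreChart (𝒢.unit (𝒢.target g₀))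
  have hut : ContMDiff 𝓘(ℝ, F) 𝓘(ℝ, F) ∞ (fun g => 𝒢.unit (𝒢.target g)) :=
    𝒢.contMDiff_unit.comp 𝒢.contMDiff_target
  let O₀ : Set G := (fun g => 𝒢.unit (𝒢.target g)) ⁻¹' c.dom
  have hO₀ : IsOpen O₀ := c.isOpen_dom.preimage hut.continuous
  let κ : G × ℝ → M × W := fun p =>
    (𝒢.target p.1, c.fib (𝒢.unit (𝒢.target p.1)) + p.2 • X.coord c (𝒢.target p.1))
  let m : G × ℝ → G := fun p => 𝒢.mul p.1 (c.arr (κ p))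
  have hκ : ContMDiffOn (𝓘(ℝ, F).prod 𝓘(ℝ, ℝ)) (𝓘(ℝ, E).prod 𝓘(ℝ, W)) ∞ κ (O₀ ×ˢ univ) := by
    rintro p ⟨hp, -⟩
    have h1 : ContMDiffAt (𝓘(ℝ, F).prod 𝓘(ℝ, ℝ)) 𝓘(ℝ, E) ∞ (fun p : G × ℝ => 𝒢.target p.1) p :=
      𝒢.contMDiff_target.contMDiffAt.comp p contMDiffAt_fst
    have h2 : ContMDiffAt (𝓘(ℝ, F).prod 𝓘(ℝ, ℝ)) 𝓘(ℝ, W) ∞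
        (fun p : G × ℝ => c.fib (𝒢.unit (𝒢.target p.1))) p :=
      ((c.contMDiffOn_fib.contMDiffAt (c.isOpen_dom.mem_nhds hp)).comp p.1
        hut.contMDiffAt).comp p contMDiffAt_fst
    have h3 : ContMDiffAt (𝓘(ℝ, F).prod 𝓘(ℝ, ℝ)) 𝓘(ℝ, W) ∞
        (fun p : G × ℝ => X.coord c (𝒢.target p.1)) p :=
      ContMDiffAt.comp p (g := X.coord c) (X.contMDiffAt_coord c hp) h1
    exact (h1.prodMk (h2.add (contMDiffAt_snd.smul h3))).contMDiffWithinAt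
  let O : Set (G × ℝ) := (O₀ ×ˢ univ) ∩ κ ⁻¹' c.cod
  have hO : IsOpen O :=
    hκ.continuousOn.isOpen_inter_preimage (hO₀.prod isOpen_univ) c.isOpen_cod
  have hm : ContMDiffOn (𝓘(ℝ, F).prod 𝓘(ℝ, ℝ)) 𝓘(ℝ, F) ∞ m O := by
    have h1 : ContMDiffOn (𝓘(ℝ, F).prod 𝓘(ℝ, ℝ)) (𝓘(ℝ, F).prod 𝓘(ℝ, F)) ∞
        (fun p : G × ℝ => (p.1, c.arr (κ p))) O :=
      contMDiffOn_fst.prodMk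
        (c.contMDiffOn_arr.comp (hκ.mono inter_subset_left) inter_subset_right)
    exact 𝒢.contMDiffOn_mul.comp h1 fun p hp => (c.source_arr _ hp.2).symm
  -- the field is the differential of `m` applied to the unit vectors `∂/∂t` at `(g, 0)`
  have hσ : ContMDiff 𝓘(ℝ, F) (𝓘(ℝ, F).prod 𝓘(ℝ, ℝ)).tangent ∞
      (fun g : G => (⟨(g, (0 : ℝ)), ((0 : F), (1 : ℝ))⟩ :
        TangentBundle (𝓘(ℝ, F).prod 𝓘(ℝ, ℝ)) (G × ℝ))) := by
    have h1 : ContMDiff 𝓘(ℝ, F) 𝓘(ℝ, F).tangent ∞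
        (fun g : G => (⟨g, (0 : F)⟩ : TangentBundle 𝓘(ℝ, F) G)) :=
      Bundle.contMDiff_zeroSection ℝ (TangentSpace 𝓘(ℝ, F) : G → Type _)
    have h2 : ContMDiff 𝓘(ℝ, F) 𝓘(ℝ, ℝ).tangent ∞
        (fun _ : G => (⟨(0 : ℝ), (1 : ℝ)⟩ : TangentBundle 𝓘(ℝ, ℝ) ℝ)) := contMDiff_const
    exact contMDiff_equivTangentBundleProd_symm.comp (h1.prodMk h2)
  have hO₀O : ∀ g ∈ O₀, (g, (0 : ℝ)) ∈ O := fun g hg =>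
    ⟨⟨hg, mem_univ _⟩, by simpa [κ] using mem_cod_unit c hg⟩
  refine (hm.contMDiffAt_tangentMap_comp hO hσ.contMDiffAt
    (hO₀O g₀ hc)).congr_of_eventuallyEq ?_
  filter_upwards [hO₀.mem_nhds hc] with g hg
  have hvel : HasVelocityAt 𝓘(ℝ, F) (fun t : ℝ => m (g, t)) 0 (X.leftInvariant g) :=
    X.hasVelocityAt_leftInvariant g (X.hasVelocityAt_curve c hg) (curve_zero c hg _)
      (c.source_curve (mem_cod_unit c hg) (X.coord c (𝒢.target g)))
  have hmd := ((hm.contMDiffAt (hO.mem_nhds (hO₀O g hg))).mdifferentiableAt (by simp)).hasMFDerivAt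
  have hvel2 : HasVelocityAt (𝓘(ℝ, F).prod 𝓘(ℝ, ℝ)) (fun t : ℝ => (g, t)) 0
      (((0 : F), (1 : ℝ)) : F × ℝ) := by
    have := HasMFDerivAt.prodMk (hasMFDerivAt_const (I := 𝓘(ℝ, ℝ)) (I' := 𝓘(ℝ, F)) g (0 : ℝ))
      (hasMFDerivAt_id (I := 𝓘(ℝ, ℝ)) (0 : ℝ))
    refine this.congr_mfderiv (ContinuousLinearMap.ext_ring ?_)
    change ((0 : F), (1 : ℝ)) = (1 : ℝ) • ((0 : F), (1 : ℝ))
    simp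
  have huniq := hvel.unique (HasVelocityAt.comp hmd hvel2)
  have hm0 : m (g, 0) = g := by
    have := curve_zero c hg (X.coord c (𝒢.target g))
    change 𝒢.mul g (c.curve (𝒢.target g) _ _ 0) = g
    rw [this, 𝒢.mul_unit]
  refine Bundle.TotalSpace.ext hm0.symm ?_
  exact heq_of_eq huniq

end AlgebroidSection
end LieGroupoid

end

/-! ### Exponentials of sections with compact support -/

noncomputable section
open Set Metric

namespace LieGroupoid

universe u
variable {E : Type*} {F : Type u} {M G : Type*}
  [NormedAddCommGroup E] [NormedSpace ℝ E] [NormedAddCommGroup F] [NormedSpace ℝ F]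
  [TopologicalSpace M] [ChartedSpace E M] [TopologicalSpace G] [ChartedSpace F G]
  {𝒢 : LieGroupoid E F M G}

lemma contMDiff_secMul [IsManifold 𝓘(ℝ, E) ∞ M] [IsManifold 𝓘(ℝ, F) ∞ G] {s w : M → G}
    (hs : ContMDiff 𝓘(ℝ, E) 𝓘(ℝ, F) ∞ s) (hw : ContMDiff 𝓘(ℝ, E) 𝓘(ℝ, F) ∞ w)
    (hws : ∀ y, 𝒢.source (w y) = y) : ContMDiff 𝓘(ℝ, E) 𝓘(ℝ, F) ∞ (𝒢.secMul s w) := by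
  have h1 : ContMDiff 𝓘(ℝ, E) (𝓘(ℝ, F).prod 𝓘(ℝ, F)) ∞
      (fun y => (s y, w (𝒢.target (s y)))) :=
    hs.prodMk (hw.comp (𝒢.contMDiff_target.comp hs))
  rw [← contMDiffOn_univ] at h1 ⊢
  exact 𝒢.contMDiffOn_mul.comp h1 fun y _ => (hws _).symm

namespace AlgebroidSection

section
variable [IsManifold 𝓘(ℝ, E) ∞ M] [IsManifold 𝓘(ℝ, F) ∞ G] [FiniteDimensional ℝ F]

lemma mfderiv_source_leftInvariant (X : 𝒢.AlgebroidSection) (g : G) :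
    mfderiv 𝓘(ℝ, F) 𝓘(ℝ, E) 𝒢.source g (X.leftInvariant g) = 0 := by
  obtain ⟨γ, hγ, h0, hs⟩ := X.exists_curve (𝒢.target g)
  have h1 := X.hasVelocityAt_leftInvariant g hγ h0 hs
  have hg : 𝒢.mul g (γ 0) = g := by rw [h0, 𝒢.mul_unit]
  have h2 := ((𝒢.contMDiff_source g).mdifferentiableAt (by simp)).hasMFDerivAt
  rw [← hg] at h2
  have h3 := HasVelocityAt.comp h2 h1
  rw [hg] at h3
  have h4 : HasVelocityAt 𝓘(ℝ, E) (fun _ : ℝ => 𝒢.source g) 0 (0 : E) := by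
    refine (hasMFDerivAt_const (I := 𝓘(ℝ, ℝ)) (I' := 𝓘(ℝ, E)) (𝒢.source g) (0 : ℝ)).congr_mfderiv
      (ContinuousLinearMap.ext_ring ?_)
    change (0 : E) = (1 : ℝ) • (0 : E)
    simp
  refine h3.unique (h4.congr ?_)
  filter_upwards [hs] with s hs
  exact 𝒢.source_mul _ _ hs.symm

lemma leftInvariant_unit (X : 𝒢.AlgebroidSection) (y : M) :
    (X.leftInvariant (𝒢.unit y) : F) = X.val y := by
  obtain ⟨γ, hγ, h0, hs⟩ := X.exists_curve y
  have ht := 𝒢.target_unit y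
  have h1 := X.hasVelocityAt_leftInvariant (𝒢.unit y) (γ := γ) (by rw [ht]; exact hγ)
    (by rw [ht]; exact h0) (by rw [ht]; exact hs)
  refine h1.unique (hγ.congr ?_)
  filter_upwards [hs] with s hs
  conv_lhs => rw [← hs]
  exact 𝒢.unit_mul _

lemma leftInvariant_eq_zero (X : 𝒢.AlgebroidSection) {g : G} (h : X.val (𝒢.target g) = 0) :
    X.leftInvariant g = 0 := by
  have := X.leftInvariant_eq g
  rw [h, map_zero] at this
  exact this

lemma contMDiff_leftInvariant_one (X : 𝒢.AlgebroidSection) :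
    ContMDiff 𝓘(ℝ, F) 𝓘(ℝ, F).tangent 1
      (fun g => (⟨g, X.leftInvariant g⟩ : TangentBundle 𝓘(ℝ, F) G)) :=
  X.contMDiff_leftInvariant.of_le (by simp)

/-- Integral curves of left invariant vector fields stay in a source fibre. -/
lemma source_eq_of_isMIntegralCurveOn [T2Space M] (X : 𝒢.AlgebroidSection) {γ : ℝ → G} {ε : ℝ}
    (hγ : IsMIntegralCurveOn (I := 𝓘(ℝ, F)) γ X.leftInvariant (Ioo (-ε) ε)) {t : ℝ}
    (ht : t ∈ Ioo (-ε) ε) : 𝒢.source (γ t) = 𝒢.source (γ 0) := by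
  have h0 : (0 : ℝ) ∈ Ioo (-ε) ε := by
    have := ht.1.trans ht.2
    constructor <;> linarith
  have hv : ContMDiff 𝓘(ℝ, E) 𝓘(ℝ, E).tangent 1
      (fun y : M => (⟨y, (0 : TangentSpace 𝓘(ℝ, E) y)⟩ : TangentBundle 𝓘(ℝ, E) M)) :=
    Bundle.contMDiff_zeroSection ℝ (TangentSpace 𝓘(ℝ, E) : M → Type _)
  have h1 : IsMIntegralCurveOn (I := 𝓘(ℝ, E)) (fun t => 𝒢.source (γ t))
      (fun y => (0 : TangentSpace 𝓘(ℝ, E) y)) (Ioo (-ε) ε) := by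
    refine isMIntegralCurveOn_of_hasVelocityAt fun s hs => ?_
    have h2 := HasVelocityAt.comp
      ((𝒢.contMDiff_source (γ s)).mdifferentiableAt (by simp)).hasMFDerivAt
      (hγ.hasVelocityAt (isOpen_Ioo.mem_nhds hs))
    have h3 := X.mfderiv_source_leftInvariant (γ s)
    have h4 : (mfderiv 𝓘(ℝ, F) 𝓘(ℝ, E) 𝒢.source (γ s) (X.leftInvariant (γ s)) : E) = (0 : E) := h3
    exact h4 ▸ h2
  have h2 : IsMIntegralCurveOn (I := 𝓘(ℝ, E)) (fun _ : ℝ => 𝒢.source (γ 0))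
      (fun y => (0 : TangentSpace 𝓘(ℝ, E) y)) (Ioo (-ε) ε) :=
    (isMIntegralCurve_const (x := 𝒢.source (γ 0)) rfl).isMIntegralCurveOn _
  exact isMIntegralCurveOn_Ioo_eqOn_of_contMDiff_boundaryless h0 hv h1 h2 rfl ht

/-- Left translates of integral curves are integral curves. -/
lemma isMIntegralCurveOn_mul (X : 𝒢.AlgebroidSection) {γ : ℝ → G} {S : Set ℝ} (hS : IsOpen S)
    (hγ : IsMIntegralCurveOn (I := 𝓘(ℝ, F)) γ X.leftInvariant S) {g : G}
    (hs : ∀ t ∈ S, 𝒢.source (γ t) = 𝒢.target g) :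
    IsMIntegralCurveOn (I := 𝓘(ℝ, F)) (fun t => 𝒢.mul g (γ t)) X.leftInvariant S := by
  refine isMIntegralCurveOn_of_hasVelocityAt fun t ht => ?_
  have h1 := 𝒢.hasVelocityAt_mul g (γ t) (hγ.hasVelocityAt (hS.mem_nhds ht)) rfl
    (by filter_upwards [hS.mem_nhds ht] with s hs'; exact hs s hs')
  rw [← X.leftInvariant_mul (hs t ht).symm] at h1
  exact h1

/-- A section with compact support has local flows along the units, defined for a uniform time. -/
lemma exists_uniform_localFlow (X : 𝒢.AlgebroidSection) (hX : IsCompact X.support) :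
    ∃ ε > 0, ∀ y : M, ∃ O : Set M, IsOpen O ∧ y ∈ O ∧ ∃ Φ : ℝ × M → G,
      ContMDiffOn (𝓘(ℝ, ℝ).prod 𝓘(ℝ, E)) 𝓘(ℝ, F) ∞ Φ (Ioo (-ε) ε ×ˢ O) ∧
      ∀ z ∈ O, Φ (0, z) = 𝒢.unit z ∧
        IsMIntegralCurveOn (I := 𝓘(ℝ, F)) (fun t => Φ (t, z)) X.leftInvariant (Ioo (-ε) ε) := by
  let Q : ℝ → M → Prop := fun ε y => ∃ O : Set M, IsOpen O ∧ y ∈ O ∧ ∃ Φ : ℝ × M → G,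
      ContMDiffOn (𝓘(ℝ, ℝ).prod 𝓘(ℝ, E)) 𝓘(ℝ, F) ∞ Φ (Ioo (-ε) ε ×ˢ O) ∧
      ∀ z ∈ O, Φ (0, z) = 𝒢.unit z ∧
        IsMIntegralCurveOn (I := 𝓘(ℝ, F)) (fun t => Φ (t, z)) X.leftInvariant (Ioo (-ε) ε)
  have hQ : ∀ ε ε' y, ε' ≤ ε → Q ε y → Q ε' y := by
    rintro ε ε' y hle ⟨O, hO, hy, Φ, hΦ, hΦ'⟩
    have hsub : Ioo (-ε') ε' ⊆ Ioo (-ε) ε := Ioo_subset_Ioo (neg_le_neg hle) hle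
    exact ⟨O, hO, hy, Φ, hΦ.mono (prod_mono hsub subset_rfl),
      fun z hz => ⟨(hΦ' z hz).1, (hΦ' z hz).2.mono hsub⟩⟩
  obtain ⟨ε, hε, h⟩ : ∃ ε > 0, ∀ y ∈ X.support, Q ε y := by
    refine hX.induction_on (p := fun S => ∃ ε > 0, ∀ y ∈ S, Q ε y) ⟨1, one_pos, by simp⟩ ?_ ?_ ?_
    · rintro S T hST ⟨ε, hε, h⟩
      exact ⟨ε, hε, fun y hy => h y (hST hy)⟩
    · rintro S T ⟨ε, hε, h⟩ ⟨ε', hε', h'⟩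
      refine ⟨min ε ε', lt_min hε hε', ?_⟩
      rintro y (hy | hy)
      · exact hQ _ _ _ (min_le_left _ _) (h y hy)
      · exact hQ _ _ _ (min_le_right _ _) (h' y hy)
    · intro y _
      obtain ⟨O, hO, hy, ε, hε, Φ, hΦ, hΦ'⟩ :=
        exists_contMDiffOn_localFlow X.contMDiff_leftInvariant (𝒢.unit y)
      have hO' : IsOpen (𝒢.unit ⁻¹' O) := hO.preimage 𝒢.contMDiff_unit.continuous
      refine ⟨𝒢.unit ⁻¹' O, mem_nhdsWithin_of_mem_nhds (hO'.mem_nhds hy), ε, hε, fun z hz =>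
        ⟨𝒢.unit ⁻¹' O, hO', hz, fun p => Φ (p.1, 𝒢.unit p.2), ?_, fun w hw => hΦ' _ hw⟩⟩
      exact hΦ.comp (contMDiff_fst.prodMk (𝒢.contMDiff_unit.comp contMDiff_snd)).contMDiffOn
        fun p hp => hp
  refine ⟨ε, hε, fun y => ?_⟩
  by_cases hy : y ∈ X.support
  · exact h y hy
  · refine ⟨X.supportᶜ, isClosed_closure.isOpen_compl, hy, fun p => 𝒢.unit p.2,
      (𝒢.contMDiff_unit.comp contMDiff_snd).contMDiffOn, fun z hz => ⟨rfl, ?_⟩⟩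
    have hz0 : X.val (𝒢.target (𝒢.unit z)) = 0 := by
      rw [𝒢.target_unit]
      by_contra hne
      exact hz (subset_closure hne)
    exact (isMIntegralCurve_const (X.leftInvariant_eq_zero hz0)).isMIntegralCurveOn _

/-- The maps `e t : M → G` are the flow of the left invariant vector field along the units, that
is, `e t = exp (t X)`. -/
def IsFlow (X : 𝒢.AlgebroidSection) (e : ℝ → M → G) : Prop :=
  ∀ y, e 0 y = 𝒢.unit y ∧ IsMIntegralCurve (I := 𝓘(ℝ, F)) (fun t => e t y) X.leftInvariant

lemma exists_isFlow [T2Space M] [T2Space G] (X : 𝒢.AlgebroidSection)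
    (hX : IsCompact X.support) : ∃ e, X.IsFlow e := by
  obtain ⟨ε, hε, h⟩ := X.exists_uniform_localFlow hX
  have h1 : ∀ g : G, ∃ γ : ℝ → G, γ 0 = g ∧
      IsMIntegralCurveOn (I := 𝓘(ℝ, F)) γ X.leftInvariant (Ioo (-ε) ε) := by
    intro g
    -- the integral curve through `g` is the translate by `g` of the one through `1_{β g}`
    obtain ⟨O, -, hy, Φ, -, hΦ⟩ := h (𝒢.target g)
    obtain ⟨h0, hc⟩ := hΦ _ hy
    refine ⟨fun t => 𝒢.mul g (Φ (t, 𝒢.target g)), by simp only; rw [h0, 𝒢.mul_unit],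
      X.isMIntegralCurveOn_mul isOpen_Ioo hc fun t ht => ?_⟩
    rw [X.source_eq_of_isMIntegralCurveOn hc ht, h0, 𝒢.source_unit]
  choose γ hγ using exists_isMIntegralCurve_of_isMIntegralCurveOn X.contMDiff_leftInvariant_one
    hε h1
  exact ⟨fun t y => γ (𝒢.unit y) t, fun y => hγ _⟩

namespace IsFlow

variable {X : 𝒢.AlgebroidSection} {e : ℝ → M → G}

lemma source_apply [T2Space M] (h : X.IsFlow e) (t : ℝ) (y : M) : 𝒢.source (e t y) = y := by
  have ht : t ∈ Ioo (-(|t| + 1)) (|t| + 1) := abs_lt.1 (lt_add_one _)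
  rw [X.source_eq_of_isMIntegralCurveOn ((h y).2.isMIntegralCurveOn _) ht, (h y).1,
    𝒢.source_unit]

lemma eq_of_isMIntegralCurve [T2Space G] (h : X.IsFlow e) {γ : ℝ → G} {y : M}
    (h0 : γ 0 = 𝒢.unit y) (hγ : IsMIntegralCurve (I := 𝓘(ℝ, F)) γ X.leftInvariant) (t : ℝ) :
    e t y = γ t :=
  congrFun (isMIntegralCurve_Ioo_eq_of_contMDiff_boundaryless X.contMDiff_leftInvariant_one
    (h y).2 hγ ((h y).1.trans h0.symm)) t

lemma unique [T2Space G] (h : X.IsFlow e) {e' : ℝ → M → G} (h' : X.IsFlow e') : e = e' := by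
  ext t y
  exact h.eq_of_isMIntegralCurve (h' y).1 (h' y).2 t

/-- The cocycle identity `exp ((s + t) X) = exp (s X) exp (t X)`. -/
lemma add [T2Space M] [T2Space G] (h : X.IsFlow e) (s t : ℝ) (y : M) :
    e (s + t) y = 𝒢.mul (e s y) (e t (𝒢.target (e s y))) := by
  have h1 : IsMIntegralCurve (I := 𝓘(ℝ, F)) (fun t => e (t + s) y) X.leftInvariant :=
    (h y).2.comp_add s
  have h2 : IsMIntegralCurve (I := 𝓘(ℝ, F))
      (fun t => 𝒢.mul (e s y) (e t (𝒢.target (e s y)))) X.leftInvariant := by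
    rw [isMIntegralCurve_iff_isMIntegralCurveOn]
    exact X.isMIntegralCurveOn_mul isOpen_univ ((h _).2.isMIntegralCurveOn _)
      fun t _ => h.source_apply _ _
  have h3 := congrFun (isMIntegralCurve_Ioo_eq_of_contMDiff_boundaryless (t₀ := 0)
    X.contMDiff_leftInvariant_one h1 h2 (by rw [zero_add, (h _).1, 𝒢.mul_unit])) t
  rw [add_comm]
  exact h3

lemma eq_unit [T2Space G] (h : X.IsFlow e) {y : M} (hy : X.val y = 0) (t : ℝ) :
    e t y = 𝒢.unit y :=
  h.eq_of_isMIntegralCurve (γ := fun _ => 𝒢.unit y) rfl (isMIntegralCurve_const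
    (X.leftInvariant_eq_zero (by rw [𝒢.target_unit]; exact hy))) t

lemma contMDiff [T2Space M] [T2Space G] (h : X.IsFlow e) (hX : IsCompact X.support) (t : ℝ) :
    ContMDiff 𝓘(ℝ, E) 𝓘(ℝ, F) ∞ (e t) := by
  obtain ⟨ε, hε, hloc⟩ := X.exists_uniform_localFlow hX
  have hsmall : ∀ τ ∈ Ioo (-ε) ε, ContMDiff 𝓘(ℝ, E) 𝓘(ℝ, F) ∞ (e τ) := by
    intro τ hτ y
    obtain ⟨O, hO, hy, Φ, hΦ, hΦ'⟩ := hloc y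
    have h1 : ContMDiffAt 𝓘(ℝ, E) 𝓘(ℝ, F) ∞ (fun z => Φ (τ, z)) y :=
      (hΦ.contMDiffAt ((isOpen_Ioo.prod hO).mem_nhds ⟨hτ, hy⟩)).comp y
        (contMDiffAt_const.prodMk contMDiffAt_id)
    refine h1.congr_of_eventuallyEq ?_
    filter_upwards [hO.mem_nhds hy] with z hz
    exact isMIntegralCurveOn_Ioo_eqOn_of_contMDiff_boundaryless (t₀ := 0) ⟨by linarith, hε⟩
      X.contMDiff_leftInvariant_one ((h z).2.isMIntegralCurveOn _) (hΦ' z hz).2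
      ((h z).1.trans (hΦ' z hz).1.symm) hτ
  have hmul : ∀ τ ∈ Ioo (-ε) ε, ∀ n : ℕ, ContMDiff 𝓘(ℝ, E) 𝓘(ℝ, F) ∞ (e (n * τ)) := by
    intro τ hτ n
    induction n with
    | zero =>
      have : e (((0 : ℕ) : ℝ) * τ) = 𝒢.unit := by
        ext y; rw [Nat.cast_zero, zero_mul, (h y).1]
      rw [this]; exact 𝒢.contMDiff_unit
    | succ n ih =>
      have : e (((n + 1 : ℕ) : ℝ) * τ) = 𝒢.secMul (e (n * τ)) (e τ) := by
        ext y
        rw [Nat.cast_succ, add_mul, one_mul, h.add]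
        rfl
      rw [this]
      exact contMDiff_secMul ih (hsmall τ hτ) (h.source_apply τ)
  -- `e t` is the `n`-th power of `e (t / n)`, and `|t / n| < ε`
  obtain ⟨n, hn⟩ := exists_nat_gt (|t| / ε)
  have hn0 : (0 : ℝ) < n := lt_of_le_of_lt (by positivity) hn
  have ht : t = n * (t / n) := by field_simp
  rw [ht]
  refine hmul _ ?_ n
  rw [mem_Ioo, ← abs_lt, abs_div, abs_of_pos hn0, div_lt_iff₀ hn0, mul_comm]
  exact (div_lt_iff₀ hε).1 hn

/-- `β ∘ e (-t)` is a left inverse of `β ∘ e t`. -/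
lemma target_neg [T2Space M] [T2Space G] (h : X.IsFlow e) (t : ℝ) (y : M) :
    𝒢.target (e (-t) (𝒢.target (e t y))) = y := by
  have h1 := h.add t (-t) y
  rw [add_neg_cancel, (h y).1] at h1
  have h2 := congrArg 𝒢.target h1
  rw [𝒢.target_unit, 𝒢.target_mul _ _ (h.source_apply _ _).symm] at h2
  exact h2.symm

lemma isBisection [T2Space M] [T2Space G] (h : X.IsFlow e) (hX : IsCompact X.support) (t : ℝ) :
    𝒢.IsBisection (e t) where
  contMDiff := h.contMDiff hX t
  source_apply := h.source_apply t
  target_diffeo :=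
    ⟨{  toFun := fun y => 𝒢.target (e t y)
        invFun := fun y => 𝒢.target (e (-t) y)
        left_inv := h.target_neg t
        right_inv := fun y => by
          have := h.target_neg (-t) y
          rwa [neg_neg] at this
        contMDiff_toFun := 𝒢.contMDiff_target.comp (h.contMDiff hX t)
        contMDiff_invFun := 𝒢.contMDiff_target.comp (h.contMDiff hX (-t)) }, fun _ => rfl⟩

lemma isExp (h : X.IsFlow e) : X.IsExp (e 1) :=
  fun y => ⟨fun t => e t y, (h y).2, (h y).1, rfl⟩

lemma scale (h : X.IsFlow e) {Y : 𝒢.AlgebroidSection} {a : ℝ} (hY : ∀ y, Y.val y = a • X.val y) :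
    Y.IsFlow fun t => e (t * a) := by
  have hYX : Y.leftInvariant = a • X.leftInvariant := by
    ext g
    have h1 := Y.leftInvariant_eq g
    rw [hY, map_smul] at h1
    exact h1
  intro y
  refine ⟨by simp only; rw [zero_mul, (h y).1], ?_⟩
  rw [hYX]
  exact (h y).2.comp_mul a

end IsFlow
end
end AlgebroidSection
end LieGroupoid

end

/-! ### Local transitivity -/

noncomputable section
open Set Metric

namespace LieGroupoid

universe u
variable {E : Type*} {F : Type u} {M G : Type*}
  [NormedAddCommGroup E] [NormedSpace ℝ E] [NormedAddCommGroup F] [NormedSpace ℝ F]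
  [TopologicalSpace M] [ChartedSpace E M] [TopologicalSpace G] [ChartedSpace F G]
  [IsManifold 𝓘(ℝ, E) ∞ M] [IsManifold 𝓘(ℝ, F) ∞ G]
  {𝒢 : LieGroupoid E F M G}
  {W : Type*} [NormedAddCommGroup W] [NormedSpace ℝ W]

/-- The value at `y` of the section with constant coordinate `v` in a fibre chart, multiplied by
the cut-off function `χ`. -/
def FibreChart.cutoffVal (c : 𝒢.FibreChart W) (χ : M → ℝ) (v : W) (y : M) :
    TangentSpace 𝓘(ℝ, F) (𝒢.unit y) :=
  (mfderiv (𝓘(ℝ, E).prod 𝓘(ℝ, W)) 𝓘(ℝ, F) c.arr (y, c.fib (𝒢.unit y))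
    ((0, χ y • v) : E × W) : F)

lemma FibreChart.cutoffVal_eq_zero (c : 𝒢.FibreChart W) {χ : M → ℝ} {y : M} (hy : χ y = 0)
    (v : W) : c.cutoffVal χ v y = 0 := by
  unfold FibreChart.cutoffVal
  rw [hy, zero_smul]
  exact map_zero (mfderiv (𝓘(ℝ, E).prod 𝓘(ℝ, W)) 𝓘(ℝ, F) c.arr (y, c.fib (𝒢.unit y)))

lemma FibreChart.hasVelocityAt_cutoffVal (c : 𝒢.FibreChart W) (χ : M → ℝ) (v : W) {y : M}
    (hy : 𝒢.unit y ∈ c.dom) :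
    HasVelocityAt 𝓘(ℝ, F) (c.curve y (c.fib (𝒢.unit y)) (χ y • v)) 0 (c.cutoffVal χ v y) :=
  c.hasVelocityAt_curve (AlgebroidSection.mem_cod_unit c hy) (χ y • v)

/-- The section of the Lie algebroid with constant coordinate `v` in a fibre chart, multiplied by
a cut-off function whose support lies in the domain of the chart. -/
def FibreChart.cutoffSection (c : 𝒢.FibreChart W) (χ : M → ℝ) (hχ : ContMDiff 𝓘(ℝ, E) 𝓘(ℝ, ℝ) ∞ χ)
    (hsupp : ∀ y ∈ tsupport χ, 𝒢.unit y ∈ c.dom) (v : W) : 𝒢.AlgebroidSection where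
  val := c.cutoffVal χ v
  mfderiv_source y := by
    by_cases hy : y ∈ tsupport χ
    · have hu := hsupp y hy
      have h1 := c.hasVelocityAt_cutoffVal χ v hu
      have h0 := AlgebroidSection.curve_zero c hu (χ y • v)
      have h2 := ((𝒢.contMDiff_source (𝒢.unit y)).mdifferentiableAt (by simp)).hasMFDerivAt
      rw [← h0] at h2
      have h3 := HasVelocityAt.comp h2 h1
      rw [h0] at h3
      have h4 : HasVelocityAt 𝓘(ℝ, E) (fun _ : ℝ => y) 0 (0 : E) := by
        refine (hasMFDerivAt_const (I := 𝓘(ℝ, ℝ)) (I' := 𝓘(ℝ, E)) y (0 : ℝ)).congr_mfderiv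
          (ContinuousLinearMap.ext_ring ?_)
        change (0 : E) = (1 : ℝ) • (0 : E)
        simp
      exact h3.unique (h4.congr (c.source_curve (AlgebroidSection.mem_cod_unit c hu) _))
    · rw [c.cutoffVal_eq_zero (image_eq_zero_of_notMem_tsupport hy), map_zero]
  contMDiff := by
    intro y
    by_cases hy : y ∈ tsupport χ
    · have hu := hsupp y hy
      have hu' : ∀ᶠ z in 𝓝 y, 𝒢.unit z ∈ c.dom :=
        𝒢.contMDiff_unit.continuous.continuousAt.preimage_mem_nhds (c.isOpen_dom.mem_nhds hu)
      have h1 : ContMDiffAt 𝓘(ℝ, E) 𝓘(ℝ, E).tangent ∞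
          (fun z : M => (⟨z, (0 : E)⟩ : TangentBundle 𝓘(ℝ, E) M)) y :=
        (Bundle.contMDiff_zeroSection ℝ (TangentSpace 𝓘(ℝ, E) : M → Type _)).contMDiffAt
      have h2 : ContMDiffAt 𝓘(ℝ, E) 𝓘(ℝ, W) ∞ (fun z => c.fib (𝒢.unit z)) y :=
        ContMDiffAt.comp y (c.contMDiffOn_fib.contMDiffAt (c.isOpen_dom.mem_nhds hu))
          𝒢.contMDiff_unit.contMDiffAt
      have h3 : ContMDiffAt 𝓘(ℝ, E) 𝓘(ℝ, W).tangent ∞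
          (fun z : M => (⟨c.fib (𝒢.unit z), χ z • v⟩ : TangentBundle 𝓘(ℝ, W) W)) y :=
        Bundle.contMDiffAt_totalSpace.2 ⟨h2, by
          have h : ContMDiffAt 𝓘(ℝ, E) 𝓘(ℝ, W) ∞ (fun z => χ z • v) y :=
            hχ.contMDiffAt.smul contMDiffAt_const
          simpa using h⟩
      have h4 : ContMDiffAt 𝓘(ℝ, E) (𝓘(ℝ, E).prod 𝓘(ℝ, W)).tangent ∞
          (fun z : M => (⟨(z, c.fib (𝒢.unit z)), ((0, χ z • v) : E × W)⟩ :
            TangentBundle (𝓘(ℝ, E).prod 𝓘(ℝ, W)) (M × W))) y :=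
        contMDiff_equivTangentBundleProd_symm.contMDiffAt.comp y (h1.prodMk h3)
      refine (c.contMDiffOn_arr.contMDiffAt_tangentMap_comp c.isOpen_cod h4
        (AlgebroidSection.mem_cod_unit c hu)).congr_of_eventuallyEq ?_
      filter_upwards [hu'] with z hz
      have h5 : c.arr (z, c.fib (𝒢.unit z)) = 𝒢.unit z := by
        have := c.arr_fib _ hz
        rwa [𝒢.source_unit] at this
      exact Bundle.TotalSpace.ext h5.symm (heq_of_eq rfl)
    · have h1 : ContMDiffAt 𝓘(ℝ, E) 𝓘(ℝ, F).tangent ∞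
          (fun z : M => (⟨𝒢.unit z, (0 : F)⟩ : TangentBundle 𝓘(ℝ, F) G)) y :=
        ((Bundle.contMDiff_zeroSection ℝ (TangentSpace 𝓘(ℝ, F) : G → Type _)).comp
          𝒢.contMDiff_unit).contMDiffAt
      refine h1.congr_of_eventuallyEq ?_
      filter_upwards [(isClosed_tsupport χ).isOpen_compl.mem_nhds hy] with z hz
      rw [c.cutoffVal_eq_zero (image_eq_zero_of_notMem_tsupport hz)]
      rfl

section
variable {c : 𝒢.FibreChart W} {χ : M → ℝ} {hχ : ContMDiff 𝓘(ℝ, E) 𝓘(ℝ, ℝ) ∞ χ}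
    {hsupp : ∀ y ∈ tsupport χ, 𝒢.unit y ∈ c.dom}

lemma FibreChart.support_cutoffSection_subset (v : W) :
    (c.cutoffSection χ hχ hsupp v).support ⊆ tsupport χ :=
  closure_mono fun _ hy hχy => hy (c.cutoffVal_eq_zero hχy v)

/-- The left invariant vector fields of the cut-off sections depend linearly on the coordinate. -/
lemma FibreChart.exists_linear_leftInvariant (hsupp : ∀ y ∈ tsupport χ, 𝒢.unit y ∈ c.dom) (g : G) :
    ∃ A : W →ₗ[ℝ] F, ∀ v, (c.cutoffSection χ hχ hsupp v).leftInvariant g = A v := by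
  let B : E × W →L[ℝ] F := mfderiv (𝓘(ℝ, E).prod 𝓘(ℝ, W)) 𝓘(ℝ, F) c.arr
    (𝒢.target g, c.fib (𝒢.unit (𝒢.target g)))
  let C : F →L[ℝ] F := mfderivWithin 𝓘(ℝ, F) 𝓘(ℝ, F) (fun h => 𝒢.mul g h)
      (𝒢.sourceFiber (𝒢.target g)) (𝒢.unit (𝒢.target g))
  refine ⟨C.toLinearMap ∘ₗ B.toLinearMap ∘ₗ LinearMap.inr ℝ E W ∘ₗ
    (χ (𝒢.target g) • LinearMap.id), fun v => rfl⟩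

lemma FibreChart.cutoffSection_smul (a : ℝ) (v : W) (y : M) :
    (c.cutoffSection χ hχ hsupp (a • v)).val y = a • (c.cutoffSection χ hχ hsupp v).val y := by
  let B : E × W →L[ℝ] F := mfderiv (𝓘(ℝ, E).prod 𝓘(ℝ, W)) 𝓘(ℝ, F) c.arr
    (y, c.fib (𝒢.unit y))
  change B (0, χ y • a • v) = a • B (0, χ y • v)
  rw [← map_smul, Prod.smul_mk, smul_zero, smul_comm]

/-- The vector field on `G × W` which at `(g, w)` is the left invariant vector field of the section
with coordinate `w` is smooth. -/
lemma FibreChart.contMDiff_parametrized [FiniteDimensional ℝ F] [FiniteDimensional ℝ W] :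
    ContMDiff (𝓘(ℝ, F).prod 𝓘(ℝ, W)) (𝓘(ℝ, F).prod 𝓘(ℝ, W)).tangent ∞
      (fun p : G × W => (⟨p, (((c.cutoffSection χ hχ hsupp p.2).leftInvariant p.1, 0) : F × W)⟩ :
        TangentBundle (𝓘(ℝ, F).prod 𝓘(ℝ, W)) (G × W))) := by
  let b := Module.finBasis ℝ W
  let S : Fin (Module.finrank ℝ W) → ∀ p : G × W, TangentSpace (𝓘(ℝ, F).prod 𝓘(ℝ, W)) p :=
    fun i p => (((c.cutoffSection χ hχ hsupp (b i)).leftInvariant p.1, 0) : F × W)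
  have hS : ∀ i, ContMDiff (𝓘(ℝ, F).prod 𝓘(ℝ, W)) (𝓘(ℝ, F).prod 𝓘(ℝ, W)).tangent ∞
      (fun p => (⟨p, S i p⟩ : TangentBundle (𝓘(ℝ, F).prod 𝓘(ℝ, W)) (G × W))) := by
    intro i
    have h1 := (c.cutoffSection χ hχ hsupp (b i)).contMDiff_leftInvariant.comp
      (contMDiff_fst (I := 𝓘(ℝ, F)) (J := 𝓘(ℝ, W)) (M := G) (N := W))
    have h2 : ContMDiff (𝓘(ℝ, F).prod 𝓘(ℝ, W)) 𝓘(ℝ, W).tangent ∞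
        (fun p : G × W => (⟨p.2, (0 : W)⟩ : TangentBundle 𝓘(ℝ, W) W)) :=
      (Bundle.contMDiff_zeroSection ℝ (TangentSpace 𝓘(ℝ, W) : W → Type _)).comp contMDiff_snd
    exact contMDiff_equivTangentBundleProd_symm.comp (h1.prodMk h2)
  have hcoef : ∀ i, ContMDiff (𝓘(ℝ, F).prod 𝓘(ℝ, W)) 𝓘(ℝ, ℝ) ∞
      (fun p : G × W => b.coord i p.2) := fun i =>
    ((b.coord i).toContinuousLinearMap.contDiff.contMDiff).comp contMDiff_snd
  have hsum := ContMDiff.sum_section (s := Finset.univ) (fun i _ => (hcoef i).smul_section (hS i))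
  refine hsum.congr fun p => ?_
  congr 1
  obtain ⟨A, hA⟩ := FibreChart.exists_linear_leftInvariant (hχ := hχ) hsupp p.1
  have hpair : ∀ v, (((c.cutoffSection χ hχ hsupp v).leftInvariant p.1, 0) : F × W) =
      LinearMap.inl ℝ F W (A v) := fun v => Prod.ext (hA v) rfl
  change (((c.cutoffSection χ hχ hsupp p.2).leftInvariant p.1, 0) : F × W) =
    ∑ i, b.coord i p.2 • (((c.cutoffSection χ hχ hsupp (b i)).leftInvariant p.1, 0) : F × W)
  simp only [hpair]
  conv_lhs => rw [← b.sum_repr p.2]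
  simp only [map_sum, map_smul, Module.Basis.coord_apply]

end

/-- **Local transitivity.** Every arrow of the source fibre over `y₀` close to `1_{y₀}` is the value
at `y₀` of `exp X` for a section `X` with compact support in a given neighbourhood of `y₀`. The
section `Y` is `-X`, whose exponential gives the inverse. -/
theorem eventually_exists_exp [FiniteDimensional ℝ E] [FiniteDimensional ℝ F] [T2Space M]
    [T2Space G] (𝒢 : LieGroupoid E F M G) {U : Set M} (hU : IsOpen U) {y₀ : M} (hy₀ : y₀ ∈ U) :
    ∀ᶠ k in 𝓝 (𝒢.unit y₀), 𝒢.source k = y₀ → ∃ (X Y : 𝒢.AlgebroidSection) (e : ℝ → M → G),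
      IsCompact X.support ∧ X.support ⊆ U ∧ IsCompact Y.support ∧ Y.support ⊆ U ∧
      X.IsFlow e ∧ Y.IsFlow (fun t => e (-t)) ∧ e 1 y₀ = k := by
  obtain ⟨W, _, _, _, c, hc⟩ := 𝒢.exists_fibreChart (𝒢.unit y₀)
  have hN : U ∩ 𝒢.unit ⁻¹' c.dom ∈ 𝓝 y₀ := Filter.inter_mem (hU.mem_nhds hy₀)
    ((c.isOpen_dom.preimage 𝒢.contMDiff_unit.continuous).mem_nhds hc)
  obtain ⟨χ, -, hχN⟩ := (SmoothBumpFunction.nhds_basis_tsupport (I := 𝓘(ℝ, E)) y₀).mem_iff.1 hN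
  have hχ : ContMDiff 𝓘(ℝ, E) 𝓘(ℝ, ℝ) ∞ χ := χ.contMDiff
  have hχ1 : χ y₀ = 1 := χ.eq_one
  have hχc : IsCompact (tsupport χ) := χ.hasCompactSupport
  have hsupp : ∀ y ∈ tsupport χ, 𝒢.unit y ∈ c.dom := fun y hy => (hχN hy).2
  let X : W → 𝒢.AlgebroidSection := c.cutoffSection χ hχ hsupp
  have hXs : ∀ v, (X v).support ⊆ tsupport χ := FibreChart.support_cutoffSection_subset
  have hXc : ∀ v, IsCompact (X v).support := fun v =>
    hχc.of_isClosed_subset isClosed_closure (hXs v)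
  have hXU : ∀ v, (X v).support ⊆ U := fun v => (hXs v).trans fun y hy => (hχN hy).1
  choose e he using fun v => (X v).exists_isFlow (hXc v)
  have hscale : ∀ (a : ℝ) v t y, e (a • v) t y = e v (t * a) y := fun a v t y => by
    have h1 := (he v).scale (Y := X (a • v)) (FibreChart.cutoffSection_smul a v)
    rw [(he (a • v)).unique h1]
  -- joint smoothness of `(t, v) ↦ exp (t X_v) (y₀)` near `(0, 0)`
  obtain ⟨O, hO, hmem, ε, hε, Φ, hΦ, hΦ'⟩ := exists_contMDiffOn_localFlow
    (FibreChart.contMDiff_parametrized (c := c) (hχ := hχ) (hsupp := hsupp)) (𝒢.unit y₀, (0 : W))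
  have hev : ∀ v, (𝒢.unit y₀, v) ∈ O → ∀ t ∈ Ioo (-ε) ε, e v t y₀ = (Φ (t, (𝒢.unit y₀, v))).1 := by
    intro v hv t ht
    obtain ⟨h0, hcurve⟩ := hΦ' _ hv
    have h1 : IsMIntegralCurveOn (I := 𝓘(ℝ, F).prod 𝓘(ℝ, W)) (fun t => (e v t y₀, v))
        (fun p : G × W => (((c.cutoffSection χ hχ hsupp p.2).leftInvariant p.1, 0) : F × W))
        (Ioo (-ε) ε) := by
      intro s _
      have h2 := HasMFDerivAt.prodMk ((he v y₀).2 s)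
        (hasMFDerivAt_const (I := 𝓘(ℝ, ℝ)) (I' := 𝓘(ℝ, W)) v s)
      refine (h2.congr_mfderiv (ContinuousLinearMap.ext_ring ?_)).hasMFDerivWithinAt
      change ((1 : ℝ) • ((X v).leftInvariant (e v s y₀) : F), (0 : W)) =
        (1 : ℝ) • (((X v).leftInvariant (e v s y₀) : F), (0 : W))
      simp
    have h2 := isMIntegralCurveOn_Ioo_eqOn_of_contMDiff_boundaryless (t₀ := 0)
      (⟨by linarith, hε⟩ : (0 : ℝ) ∈ Ioo (-ε) ε)
      ((FibreChart.contMDiff_parametrized (c := c) (hχ := hχ) (hsupp := hsupp)).of_le (by simp))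
      h1 hcurve (by rw [h0, (he v y₀).1]) ht
    exact congrArg Prod.fst h2
  let τ : ℝ := ε / 2
  have hτ : τ ∈ Ioo (-ε) ε := ⟨by simp only [τ]; linarith, by simp only [τ]; linarith⟩
  have hτ0 : τ ≠ 0 := by simp only [τ]; positivity
  have hθ : ContMDiffAt 𝓘(ℝ, W) 𝓘(ℝ, F) ∞ (fun v => e v τ y₀) 0 := by
    have h1 : ContMDiffAt 𝓘(ℝ, W) (𝓘(ℝ, ℝ).prod (𝓘(ℝ, F).prod 𝓘(ℝ, W))) ∞
        (fun v : W => (τ, (𝒢.unit y₀, v))) 0 :=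
      contMDiffAt_const.prodMk (contMDiffAt_const.prodMk contMDiffAt_id)
    have h2 := (hΦ.contMDiffAt (x := (τ, (𝒢.unit y₀, (0 : W))))
      ((isOpen_Ioo.prod hO).mem_nhds ⟨hτ, hmem⟩)).comp 0 h1
    refine (contMDiffAt_fst.comp 0 h2).congr_of_eventuallyEq ?_
    have h3 : Continuous fun v : W => (𝒢.unit y₀, v) := by fun_prop
    filter_upwards [h3.continuousAt.preimage_mem_nhds (hO.mem_nhds hmem)] with v hv
    exact hev v hv τ hτ
  have he0 : ∀ t, e 0 t y₀ = 𝒢.unit y₀ := fun t => by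
    have := hscale 0 0 t y₀
    rwa [zero_smul, mul_zero, (he 0 y₀).1] at this
  have hfib : ContMDiffAt 𝓘(ℝ, F) 𝓘(ℝ, W) ∞ c.fib (𝒢.unit y₀) :=
    c.contMDiffOn_fib.contMDiffAt (c.isOpen_dom.mem_nhds hc)
  let P : W → W := fun v => c.fib (e v τ y₀)
  have hP : ContDiffAt ℝ ∞ P 0 := by
    rw [← contMDiffAt_iff_contDiffAt]
    exact ContMDiffAt.comp (g := c.fib) (f := fun v => e v τ y₀) 0 (by rw [he0]; exact hfib) hθ
  -- the derivative of `P` at `0` is multiplication by `τ`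
  have hfX : ∀ v, (mfderiv 𝓘(ℝ, F) 𝓘(ℝ, W) c.fib (𝒢.unit y₀) ((X v).val y₀) : W) = v := by
    intro v
    have h1 : HasVelocityAt 𝓘(ℝ, F) (c.curve y₀ (c.fib (𝒢.unit y₀)) v) 0 ((X v).val y₀) := by
      have := c.hasVelocityAt_cutoffVal χ v hc
      rwa [hχ1, one_smul] at this
    have h0 := AlgebroidSection.curve_zero c hc v
    have h2 := (hfib.mdifferentiableAt (by simp)).hasMFDerivAt
    rw [← h0] at h2
    have h3 := HasVelocityAt.comp h2 h1
    rw [h0] at h3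
    have h4 : HasVelocityAt 𝓘(ℝ, W) (fun t : ℝ => c.fib (𝒢.unit y₀) + t • v) 0 v := by
      rw [hasVelocityAt_iff_hasDerivAt]
      simpa using ((hasDerivAt_id (0 : ℝ)).smul_const v).const_add (c.fib (𝒢.unit y₀))
    refine h3.unique (h4.congr ?_)
    have h5 : Continuous fun t : ℝ => (y₀, c.fib (𝒢.unit y₀) + t • v) := by fun_prop
    filter_upwards [h5.continuousAt.preimage_mem_nhds (c.isOpen_cod.mem_nhds
      (by simpa using AlgebroidSection.mem_cod_unit c hc))] with t ht
    exact c.fib_arr _ ht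
  -- because `exp (τ X_{s v}) = exp (s τ X_v)`, the derivative in direction `v` is a time derivative
  have hder : ∀ v, fderiv ℝ P 0 v = τ • v := by
    intro v
    have h1 : HasDerivAt (fun s : ℝ => P (s • v)) (fderiv ℝ P 0 v) 0 := by
      have h2 : HasDerivAt (fun s : ℝ => s • v) v 0 := by
        simpa using (hasDerivAt_id (0 : ℝ)).smul_const v
      have h3 : HasFDerivAt P (fderiv ℝ P 0) ((0 : ℝ) • v) := by
        rw [zero_smul]; exact (hP.differentiableAt (by simp)).hasFDerivAt
      exact h3.comp_hasDerivAt 0 h2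
    have h2 : HasVelocityAt 𝓘(ℝ, F) (fun s => e v (s * τ) y₀) 0
        (τ • ((X v).val y₀ : F)) := by
      have h3 := (he v y₀).2.comp_mul τ 0
      have h4 : e v (0 * τ) y₀ = 𝒢.unit y₀ := by rw [zero_mul, (he v y₀).1]
      have h5 : ((X v).leftInvariant (e v (0 * τ) y₀) : F) = (X v).val y₀ := by
        rw [h4]; exact (X v).leftInvariant_unit y₀
      rw [← h5]
      exact h3
    have h4 : e v (0 * τ) y₀ = 𝒢.unit y₀ := by rw [zero_mul, (he v y₀).1]
    have h5 := (hfib.mdifferentiableAt (by simp)).hasMFDerivAt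
    rw [← h4] at h5
    have h6 := HasVelocityAt.comp h5 h2
    rw [h4] at h6
    replace h6 := hasVelocityAt_iff_hasDerivAt.1 h6
    have h7 : (mfderiv 𝓘(ℝ, F) 𝓘(ℝ, W) c.fib (𝒢.unit y₀) (τ • ((X v).val y₀ : F)) : W) = τ • v := by
      have := map_smul (mfderiv 𝓘(ℝ, F) 𝓘(ℝ, W) c.fib (𝒢.unit y₀)) τ ((X v).val y₀)
      exact this.trans (congrArg (fun w : W => τ • w) (hfX v))
    have h8 : (fun s : ℝ => P (s • v)) = fun s => c.fib (e v (s * τ) y₀) := by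
      ext s
      simp only [P]
      rw [hscale, mul_comm]
    rw [h8] at h1
    exact (h1.unique h6).trans h7
  let D : W ≃L[ℝ] W := ContinuousLinearEquiv.smulLeft (Units.mk0 τ hτ0)
  have hD : HasStrictFDerivAt P (D : W →L[ℝ] W) 0 := by
    refine (hP.hasStrictFDerivAt (by simp)).congr_fderiv ?_
    ext v
    exact hder v
  have hmap := hD.map_nhds_eq_of_equiv
  have hP0 : P 0 = c.fib (𝒢.unit y₀) := by simp only [P]; rw [he0]
  rw [hP0] at hmap
  have hdom : {v : W | e v τ y₀ ∈ c.dom} ∈ 𝓝 (0 : W) :=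
    hθ.continuousAt.preimage_mem_nhds (c.isOpen_dom.mem_nhds (by rw [he0]; exact hc))
  have himg : P '' {v : W | e v τ y₀ ∈ c.dom} ∈ 𝓝 (c.fib (𝒢.unit y₀)) := by
    rw [← hmap]; exact Filter.image_mem_map hdom
  filter_upwards [hfib.continuousAt.preimage_mem_nhds himg, c.isOpen_dom.mem_nhds hc]
    with k hk hkd hks
  obtain ⟨v, hv, hvk⟩ := hk
  have hke : e v τ y₀ = k := by
    have h1 := c.arr_fib _ hv
    have h2 := c.arr_fib _ hkd
    rw [(he v).source_apply] at h1
    rw [hks] at h2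
    rw [← h1, ← h2]
    exact congrArg (fun w => c.arr (y₀, w)) hvk
  refine ⟨X (τ • v), X ((-1 : ℝ) • τ • v), e (τ • v), hXc _, hXU _, hXc _, hXU _, he _, ?_, ?_⟩
  · have h1 := (he (τ • v)).scale (Y := X ((-1 : ℝ) • τ • v)) (FibreChart.cutoffSection_smul _ _)
    simpa using h1
  · rw [hscale, one_mul, hke]

end LieGroupoid

end

/-! ### Products of exponentials and connectedness -/

noncomputable section
open Set Metric

namespace LieGroupoid

universe u
variable {E : Type*} {F : Type u} {M G : Type*}
  [NormedAddCommGroup E] [NormedSpace ℝ E] [NormedAddCommGroup F] [NormedSpace ℝ F]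
  [TopologicalSpace M] [ChartedSpace E M] [TopologicalSpace G] [ChartedSpace F G]
  {𝒢 : LieGroupoid E F M G}

lemma source_secProd {l : List (M → G)} (hl : ∀ s ∈ l, ∀ y, 𝒢.source (s y) = y) (y : M) :
    𝒢.source (𝒢.secProd l y) = y := by
  induction l generalizing y with
  | nil => exact 𝒢.source_unit y
  | cons s l ih =>
    have hl' : ∀ s ∈ l, ∀ y, 𝒢.source (s y) = y := fun s hs => hl s (List.mem_cons_of_mem _ hs)
    exact (𝒢.source_mul _ _ (ih hl' _).symm).trans (hl s List.mem_cons_self y)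

lemma secProd_append {l l' : List (M → G)} (hl : ∀ s ∈ l, ∀ y, 𝒢.source (s y) = y)
    (hl' : ∀ s ∈ l', ∀ y, 𝒢.source (s y) = y) :
    𝒢.secProd (l ++ l') = 𝒢.secMul (𝒢.secProd l) (𝒢.secProd l') := by
  induction l with
  | nil =>
    ext y
    change 𝒢.secProd l' y = 𝒢.mul (𝒢.unit y) (𝒢.secProd l' (𝒢.target (𝒢.unit y)))
    rw [𝒢.target_unit]
    have h := 𝒢.unit_mul (𝒢.secProd l' y)
    rw [source_secProd hl'] at h
    exact h.symm
  | cons s l ih =>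
    have hl₁ : ∀ s ∈ l, ∀ y, 𝒢.source (s y) = y := fun s hs => hl s (List.mem_cons_of_mem _ hs)
    ext y
    change 𝒢.mul (s y) (𝒢.secProd (l ++ l') (𝒢.target (s y))) =
      𝒢.mul (𝒢.mul (s y) (𝒢.secProd l (𝒢.target (s y)))) (𝒢.secProd l'
        (𝒢.target (𝒢.mul (s y) (𝒢.secProd l (𝒢.target (s y))))))
    rw [ih hl₁, 𝒢.target_mul _ _ (source_secProd hl₁ _).symm]
    exact 𝒢.mul_assoc _ _ _ (source_secProd hl₁ _).symm (source_secProd hl' _).symm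

lemma secProd_eq_unit {l : List (M → G)} {y : M} (hl : ∀ s ∈ l, s y = 𝒢.unit y) :
    𝒢.secProd l y = 𝒢.unit y := by
  induction l with
  | nil => rfl
  | cons s l ih =>
    change 𝒢.mul (s y) (𝒢.secProd l (𝒢.target (s y))) = 𝒢.unit y
    rw [hl s List.mem_cons_self, 𝒢.target_unit,
      ih fun s hs => hl s (List.mem_cons_of_mem _ hs)]
    have := 𝒢.mul_unit (𝒢.unit y)
    rwa [𝒢.target_unit] at this

variable [IsManifold 𝓘(ℝ, E) ∞ M] [IsManifold 𝓘(ℝ, F) ∞ G]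

lemma isBisection_unit : 𝒢.IsBisection 𝒢.unit where
  contMDiff := 𝒢.contMDiff_unit
  source_apply := 𝒢.source_unit
  target_diffeo := ⟨Diffeomorph.refl _ _ _, fun y => (𝒢.target_unit y).symm⟩

lemma IsBisection.secMul {s w : M → G} (hs : 𝒢.IsBisection s) (hw : 𝒢.IsBisection w) :
    𝒢.IsBisection (𝒢.secMul s w) where
  contMDiff := contMDiff_secMul hs.contMDiff hw.contMDiff hw.source_apply
  source_apply y := (𝒢.source_mul _ _ (hw.source_apply _).symm).trans (hs.source_apply y)
  target_diffeo := by
    obtain ⟨Φ, hΦ⟩ := hs.target_diffeo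
    obtain ⟨Ψ, hΨ⟩ := hw.target_diffeo
    refine ⟨Φ.trans Ψ, fun y => ?_⟩
    have := 𝒢.target_mul (s y) (w (𝒢.target (s y))) (hw.source_apply _).symm
    exact (congrArg Ψ (hΦ y)).trans ((hΨ _).trans this.symm)

lemma isBisection_secProd {l : List (M → G)} (hl : ∀ s ∈ l, 𝒢.IsBisection s) :
    𝒢.IsBisection (𝒢.secProd l) := by
  induction l with
  | nil => exact isBisection_unit
  | cons s l ih =>
    exact (hl s List.mem_cons_self).secMul (ih fun s hs => hl s (List.mem_cons_of_mem _ hs))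

variable [FiniteDimensional ℝ F]

/-- `s` is the exponential of a section with compact support contained in `U`. -/
def IsExpOver (𝒢 : LieGroupoid E F M G) (U : Set M) (s : M → G) : Prop :=
  ∃ (X : 𝒢.AlgebroidSection) (e : ℝ → M → G),
    IsCompact X.support ∧ X.support ⊆ U ∧ X.IsFlow e ∧ s = e 1

lemma IsExpOver.isBisection [T2Space M] [T2Space G] {U : Set M} {s : M → G}
    (h : 𝒢.IsExpOver U s) : 𝒢.IsBisection s := by
  obtain ⟨X, e, hc, -, he, rfl⟩ := h
  exact he.isBisection hc 1

lemma IsExpOver.eq_unit [T2Space G] {U : Set M} {s : M → G}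
    (h : 𝒢.IsExpOver U s) {y : M} (hy : y ∉ U) : s y = 𝒢.unit y := by
  obtain ⟨X, e, -, hU, he, rfl⟩ := h
  refine he.eq_unit ?_ 1
  by_contra hne
  exact hy (hU (subset_closure hne))

lemma isFinitelyGeneratedOver_secProd {U : Set M} {l : List (M → G)}
    (hl : ∀ s ∈ l, 𝒢.IsExpOver U s) : 𝒢.IsFinitelyGeneratedOver U (𝒢.secProd l) := by
  choose X e hc hU he hs using fun i : Fin l.length => hl (l.get i) (List.get_mem l i)
  refine ⟨l.length, X, l.get, fun i => ⟨hc i, hU i, ?_⟩, by rw [List.ofFn_get]⟩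
  rw [hs i]
  exact (he i).isExp

/-- `h` and `k` are related if `k` is obtained from `h` by multiplication with a product of
exponentials of sections with compact support in `U`. -/
def Reaches (𝒢 : LieGroupoid E F M G) (U : Set M) (h k : G) : Prop :=
  ∃ l : List (M → G), (∀ s ∈ l, 𝒢.IsExpOver U s) ∧ k = 𝒢.mul h (𝒢.secProd l (𝒢.target h))

lemma Reaches.trans [T2Space M] [T2Space G] {U : Set M} {h k j : G} (h₁ : 𝒢.Reaches U h k)
    (h₂ : 𝒢.Reaches U k j) : 𝒢.Reaches U h j := by
  obtain ⟨l, hl, rfl⟩ := h₁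
  obtain ⟨l', hl', rfl⟩ := h₂
  have hs : ∀ s ∈ l, ∀ y, 𝒢.source (s y) = y := fun s hs => (hl s hs).isBisection.source_apply
  have hs' : ∀ s ∈ l', ∀ y, 𝒢.source (s y) = y := fun s hs => (hl' s hs).isBisection.source_apply
  refine ⟨l ++ l', fun s hs => ?_, ?_⟩
  · rcases List.mem_append.1 hs with h | h
    exacts [hl s h, hl' s h]
  · rw [secProd_append hs hs', 𝒢.target_mul _ _ (source_secProd hs _).symm]
    exact (𝒢.mul_assoc _ _ _ (source_secProd hs _).symm (source_secProd hs' _).symm).symm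

lemma reaches_of_isExpOver {U : Set M} {s : M → G} (hs : 𝒢.IsExpOver U s) (h : G) :
    𝒢.Reaches U h (𝒢.mul h (s (𝒢.target h))) := by
  refine ⟨[s], by simpa using hs, ?_⟩
  change _ = 𝒢.mul h (𝒢.mul (s (𝒢.target h)) (𝒢.unit (𝒢.target (s (𝒢.target h)))))
  rw [𝒢.mul_unit]

lemma continuousOn_inv_mul (𝒢 : LieGroupoid E F M G) (h : G) :
    ContinuousOn (fun k => 𝒢.mul (𝒢.inv h) k) (𝒢.sourceFiber (𝒢.source h)) := by
  intro k hk
  have := (𝒢.mdifferentiableWithinAt_mul (g := 𝒢.inv h) (h := k)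
    (by rw [𝒢.target_inv]; exact hk)).continuousWithinAt
  rwa [𝒢.target_inv] at this

/-- Left translation carries local transitivity at the unit to every arrow. -/
lemma eventually_reaches [FiniteDimensional ℝ E] [T2Space M] [T2Space G] {U : Set M}
    (hU : IsOpen U) {h : G} (hh : 𝒢.target h ∈ U) :
    ∀ᶠ k in 𝓝[𝒢.sourceFiber (𝒢.source h)] h, 𝒢.Reaches U h k ∧ 𝒢.Reaches U k h := by
  have hc := 𝒢.continuousOn_inv_mul h h rfl
  have ht : Filter.Tendsto (fun k => 𝒢.mul (𝒢.inv h) k) (𝓝[𝒢.sourceFiber (𝒢.source h)] h)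
      (𝓝 (𝒢.unit (𝒢.target h))) := by
    have := hc.tendsto
    simp only [𝒢.inv_mul] at this
    exact this
  filter_upwards [ht.eventually (𝒢.eventually_exists_exp hU hh), self_mem_nhdsWithin] with k hk hks
  have hks' : 𝒢.target (𝒢.inv h) = 𝒢.source k := (𝒢.target_inv h).trans (Eq.symm hks)
  obtain ⟨X, Y, e, hXc, hXU, hYc, hYU, hX, hY, hek⟩ :=
    hk ((𝒢.source_mul _ _ hks').trans (𝒢.source_inv h))
  have h1 : k = 𝒢.mul h (e 1 (𝒢.target h)) := by
    rw [hek, 𝒢.mul_assoc _ _ _ (𝒢.source_inv h).symm hks', 𝒢.mul_inv]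
    conv_lhs => rw [← 𝒢.unit_mul k]
    rw [show 𝒢.source k = 𝒢.source h from hks]
  constructor
  · rw [h1]
    exact reaches_of_isExpOver ⟨X, e, hXc, hXU, hX, rfl⟩ h
  · have h2 : h = 𝒢.mul k (e (-1) (𝒢.target k)) := by
      have hsrc : ∀ t y, 𝒢.source (e t y) = y := hX.source_apply
      have htk : 𝒢.target k = 𝒢.target (e 1 (𝒢.target h)) := by
        rw [h1, 𝒢.target_mul _ _ (hsrc _ _).symm]
      rw [htk]
      conv_rhs => rw [h1]
      rw [← 𝒢.mul_assoc _ _ _ (hsrc _ _).symm (hsrc _ _).symm, ← hX.add, add_neg_cancel,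
        (hX _).1, 𝒢.mul_unit]
    have h3 := reaches_of_isExpOver (𝒢 := 𝒢) (U := U) (s := e (-1))
      ⟨Y, fun t => e (-t), hYc, hYU, hY, rfl⟩ k
    rwa [← h2] at h3

end LieGroupoid

end

theorem theorem3p2 {E F M G : Type*}
    [NormedAddCommGroup E] [NormedSpace ℝ E] [FiniteDimensional ℝ E]
    [NormedAddCommGroup F] [NormedSpace ℝ F] [FiniteDimensional ℝ F]
    [TopologicalSpace M] [T2Space M] [ChartedSpace E M] [IsManifold 𝓘(ℝ, E) ∞ M]
    [TopologicalSpace G] [T2Space G] [ChartedSpace F G] [IsManifold 𝓘(ℝ, F) ∞ G]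
    (𝒢 : LieGroupoid E F M G) (x : M) (g : G) (hg : g ∈ 𝒢.sourceFiber x)
    (Utilde : Set G) (hUsub : Utilde ⊆ 𝒢.sourceFiber x)
    (hUopen : ∃ V : Set G, IsOpen V ∧ Utilde = V ∩ 𝒢.sourceFiber x)
    (hUconn : IsConnected Utilde) (hxU : 𝒢.unit x ∈ Utilde) (hgU : g ∈ Utilde)
    (U : Set M) (hU : IsOpen U) (hβU : 𝒢.target '' Utilde ⊆ U) :
    ∃ s : M → G, 𝒢.IsBisection s ∧ s x = g ∧ (∀ y ∉ U, s y = 𝒢.unit y) ∧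
      𝒢.IsFinitelyGeneratedOver U s := by
  have hreach : 𝒢.Reaches U (𝒢.unit x) g := by
    refine hUconn.isPreconnected.induction₂' (𝒢.Reaches U) (fun h hh => ?_)
      (fun _ _ _ _ _ _ h₁ h₂ => h₁.trans h₂) hxU hgU
    have hsub : Utilde ⊆ 𝒢.sourceFiber (𝒢.source h) := by rw [hUsub hh]; exact hUsub
    exact (LieGroupoid.eventually_reaches hU (hβU ⟨h, hh, rfl⟩)).filter_mono
      (nhdsWithin_mono h hsub)
  obtain ⟨l, hl, hgl⟩ := hreach
  have hb : 𝒢.IsBisection (𝒢.secProd l) :=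
    LieGroupoid.isBisection_secProd fun s hs => (hl s hs).isBisection
  refine ⟨𝒢.secProd l, hb, ?_,
    fun y hy => LieGroupoid.secProd_eq_unit fun s hs => (hl s hs).eq_unit hy,
    LieGroupoid.isFinitelyGeneratedOver_secProd hl⟩
  have h1 := 𝒢.unit_mul (𝒢.secProd l x)
  rw [hb.source_apply] at h1
  rw [𝒢.target_unit, h1] at hgl
  exact hgl.symm
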